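/- Let $B_1=[-1,1]$. Let $\psi\in C_c^\infty(\mathbb R;\mathbb C)$ be supported in $B_1$ and let $\varphi$ be real-valued, of class $C^n$ on $B_1$ ($n$ is specified in each part), with $\varphi(0)=\varphi'(0)=0$ and $\tfrac1{10}\le\varphi''(x)\le 10$ for $|x|\le1$. For $\lambda>0$ put $I(\lambda)=\int_{\mathbb R}e^{i\lambda\varphi(x)}\psi(x)\,dx$ and define $R(\lambda)$ by $$I(\lambda)=(2\pi)^{1/2}\lambda^{-1/2}\,\frac{e^{i\pi/4}\psi(0)}{\varphi''(0)^{1/2}}+R(\lambda).$$ For a function $f$ on $B_1$ write $S_{[k,j]}(f)=\sum_{l=k}^{j}\sup_{x\in B_1}|f^{(l)}(x)|$. Then the following hold. (1) For every $p\in[1,\infty)$ there is a constant $C$, independent of $\varphi,\psi,\lambda$, such that for all such $\psi$, all such $\varphi$ of class $C^3$ and all $\lambda>0$, $$|R(\lambda)|\le C\lambda^{-1+\frac1{2p}}\bigl(\|\varphi'''\|_{L^p(B_1)}\|\psi\|_{L^\infty(B_1)}+\|\psi'\|_{L^\infty(B_1)}\bigr).$$ (2) There is a universal function $C(\cdot,\cdot)$,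 nondecreasing in each argument, such that for all such $\psi$, all such $\varphi$ of class $C^4$ and all $\lambda>0$, $$|R(\lambda)|\le \lambda^{-3/2}\,C\bigl(S_{[2,4]}(\varphi),S_{[0,2]}(\psi)\bigr).$$ (3) Let $(C_k)_{k\ge0}$ be a sequence of constants. There are constants $A_K$ and $D_K$ ($K=0,1,2,\dots$), depending only on $K$ and on the sequence $(C_k)$, such that the following holds. If $\varphi$ is of class $C^\infty$ and $|\psi^{(k)}(x)|\le C_k$ and $|\varphi^{(k)}(x)|\le C_k$ for all $|x|<1$ and all $k\ge0$, then there are complex numbers $a_1,a_2,\dots$, depending only on $\varphi$ and $\psi$ (not on $K$ or $\lambda$), such that for every $K\in\{0,1,2,\dots\}$ and every $\lambda>0$ $$R(\lambda)=(2\pi)^{1/2}\lambda^{-1/2}e^{i\pi/4}\sum_{k=1}^{K}\frac{a_k\lambda^{-k}}{k!}+\tilde R_K(\lambda),$$ where $|a_k|\le A_K^{\,k}$ for $1\le k\le K$ and $|\tilde R_K(\lambda)|\le D_K\lambda^{-K-3/2}$. -/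

import Mathlib

open Set MeasureTheory
open scoped ContDiff

noncomputable section

namespace StationaryPhase

/-- The closed unit ball `{x : |x| ≤ 1}` of the real line. -/
abbrev B1 : Set ℝ := Icc (-1) 1

/-- The `k`-th derivative of a function on the closed unit ball `B1` (one-sided at the two
endpoints, the usual derivative at interior points). -/
def dB {E : Type*} [NormedAddCommGroup E] [NormedSpace ℝ E] (k : ℕ) (f : ℝ → E) (x : ℝ) : E :=
  iteratedDerivWithin k f B1 x

/-- `S_k(f)`, the supremum over `B1` of the norm of the `k`-th derivative. -/
def S {E : Type*} [NormedAddCommGroup E] [NormedSpace ℝ E] (k : ℕ) (f : ℝ → E) : ℝ :=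
  ⨆ x : B1, ‖dB k f x‖

/-- `S_{[k,j]}(f)`, the sum of `S_l(f)` over `k ≤ l ≤ j`. -/
def SRange {E : Type*} [NormedAddCommGroup E] [NormedSpace ℝ E] (k j : ℕ) (f : ℝ → E) : ℝ :=
  ∑ l ∈ Finset.Icc k j, S l f

/-- The `L^p(B1)` norm for Lebesgue measure. -/
def lpNormB1 {E : Type*} [NormedAddCommGroup E] (p : ENNReal) (f : ℝ → E) : ℝ :=
  (eLpNorm f p (volume.restrict B1)).toReal

/-- `φ` is a real phase of class `C^n` on `B1` with `φ(0) = φ'(0) = 0` and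
`1/10 ≤ φ'' ≤ 10` on `B1`. -/
structure IsPhase (n : WithTop ℕ∞) (φ : ℝ → ℝ) : Prop where
  contDiffOn : ContDiffOn ℝ n φ B1
  zero : φ 0 = 0
  deriv_zero : dB 1 φ 0 = 0
  lower : ∀ x ∈ B1, 1 / 10 ≤ dB 2 φ x
  upper : ∀ x ∈ B1, dB 2 φ x ≤ 10

/-- `ψ` is a smooth (complex-valued) amplitude supported in `B1`. -/
structure IsAmplitude (ψ : ℝ → ℂ) : Prop where
  contDiff : ContDiff ℝ ∞ ψ
  support : tsupport ψ ⊆ B1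

/-- The oscillatory integral `I(λ) = ∫ e^{iλφ(x)} ψ(x) dx`. -/
def oscInt (φ : ℝ → ℝ) (ψ : ℝ → ℂ) (lam : ℝ) : ℂ :=
  ∫ x : ℝ, Complex.exp (Complex.I * ((lam * φ x : ℝ) : ℂ)) * ψ x

/-- The factor `(2π)^{1/2} λ^{-1/2} e^{iπ/4}`. -/
def prefactor (lam : ℝ) : ℂ :=
  (((2 * Real.pi) ^ (1 / 2 : ℝ) * lam ^ (-(1 / 2) : ℝ) : ℝ) : ℂ) *
    Complex.exp (Complex.I * ((Real.pi / 4 : ℝ) : ℂ))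

/-- The remainder `R(λ) = I(λ) - (2π)^{1/2} λ^{-1/2} e^{iπ/4} ψ(0) / φ''(0)^{1/2}`. -/
def remainder (φ : ℝ → ℝ) (ψ : ℝ → ℂ) (lam : ℝ) : ℂ :=
  oscInt φ ψ lam - prefactor lam * (ψ 0 / (((dB 2 φ 0) ^ (1 / 2 : ℝ) : ℝ) : ℂ))

end StationaryPhase

end

noncomputable section

set_option linter.unusedSectionVars false

/-! Only `u = φ''` matters, extended to the line by its boundary values. Taylor's formula gives `φ'
= x m(x)` and `φ = x² q(x) / 2`, where `m` and `q` are radial averages of `u`, so both stay in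
`[1/10, 10]`. Hence `y = x √q` is a global coordinate with `φ = y² / 2`, and the amplitude `refAmp =
y' χ(y)`, with `χ = cutoff`, has an oscillatory integral equal to the truncated Fresnel integral,
whatever the phase (`IsCurvature.integral_osc_mul_refAmp`). The Fresnel integral differs from
`prefactor` by `O(λ⁻ˢ)` for every `s ≥ 1/2` (`exists_fresnel_sub_prefactor_rpow_bound`).

Subtracting from the amplitude `ψ` the multiple of `refAmp` with the same value at `0` therefore
isolates the main term and leaves a `residual` which vanishes at the critical point. This residual
is treated in two ways.

At low regularity the residual is `O(|x|^α)` with derivative `O(|x|^(α-1))`, where `α = 1 - 1/p`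
comes from Hölder's inequality for `φ'''`. Splitting the integral at `|x| = λ^(-1/2)` and
integrating by parts outside gives `O(λ^(-(1+α)/2))` (`norm_integral_osc_le`), which is (1).

At higher regularity the residual is `φ'` times a regular `quotient`, and one integration by parts
replaces it by `iλ⁻¹` times the integral with amplitude `quotient'`, called `reduce`. This integral
is `O(λ^(-1/2))` by the case `α = 0` of the splitting bound, which gives (2). Repeating subtraction
and integration by parts gives the expansion (3) (`oscB1_eq_sum`); the cutoff vanishes near `±1`, so
all boundary terms vanish.

Uniform constants are not tracked by hand: the set of all admissible pairs is one indexed family,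
and `UniformCk` records that bounds common to a family survive every operation used. -/

namespace StationaryPhase

/-! ### Radial averages and the Hadamard quotient on `B1`. -/

section Averaging

variable {E : Type*} [NormedAddCommGroup E] [NormedSpace ℝ E]

/-- The extension of a function on `B1` to the line by its boundary values. -/
def clamp (f : ℝ → E) : ℝ → E :=
  IccExtend (neg_le_self zero_le_one : (-1 : ℝ) ≤ 1) ((Icc (-1 : ℝ) 1).domRestrict f)

lemma clamp_eq (f : ℝ → E) {x : ℝ} (hx : x ∈ B1) : clamp f x = f x := by
  rw [clamp, IccExtend_of_mem _ _ hx]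
  rfl

lemma continuous_clamp {f : ℝ → E} (hf : ContinuousOn f B1) : Continuous (clamp f) :=
  (continuousOn_iff_continuous_domRestrict.1 hf).Icc_extend'

lemma exists_clamp_eq (f : ℝ → E) (x : ℝ) : ∃ y ∈ B1, clamp f x = f y :=
  ⟨projIcc (-1 : ℝ) 1 (neg_le_self zero_le_one) x, Subtype.mem _, rfl⟩

lemma zero_mem_B1 : (0 : ℝ) ∈ B1 := by constructor <;> norm_num

lemma uniqueDiffOn_B1 : UniqueDiffOn ℝ B1 := uniqueDiffOn_Icc (by norm_num)

lemma mul_mem_B1 {t x : ℝ} (ht : t ∈ Icc (0 : ℝ) 1) (hx : x ∈ B1) : t * x ∈ B1 := by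
  have := abs_le.2 hx
  refine abs_le.1 ?_
  rw [abs_mul, abs_of_nonneg ht.1]
  nlinarith [ht.1, ht.2, abs_nonneg x]

/-- The weighted radial average `∫₀¹ w(t) f(tx) dt`. -/
def avg (w : ℝ → ℝ) (f : ℝ → E) (x : ℝ) : E := ∫ t in (0 : ℝ)..1, w t • f (t * x)

lemma avg_congr {w : ℝ → ℝ} {f g : ℝ → E} (h : EqOn f g B1) : EqOn (avg w f) (avg w g) B1 := by
  intro x hx
  refine intervalIntegral.integral_congr fun t ht => ?_
  rw [uIcc_of_le zero_le_one] at ht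
  simp only [h (mul_mem_B1 ht hx)]

lemma continuous_avg {w : ℝ → ℝ} {f : ℝ → E} (hw : Continuous w) (hf : Continuous f) :
    Continuous (avg w f) := by
  refine intervalIntegral.continuous_parametric_intervalIntegral_of_continuous' ?_ 0 1
  fun_prop

lemma continuousOn_avg {w : ℝ → ℝ} {f : ℝ → E} (hw : Continuous w) (hf : ContinuousOn f B1) :
    ContinuousOn (avg w f) B1 :=
  (continuous_avg hw (continuous_clamp hf)).continuousOn.congr
    (avg_congr fun _ hx => (clamp_eq f hx).symm)

lemma norm_avg_le {w : ℝ → ℝ} {f : ℝ → E} {W C x : ℝ} (hw : ∀ t ∈ Icc (0 : ℝ) 1, |w t| ≤ W)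
    (hf : ∀ t ∈ Icc (0 : ℝ) 1, ‖f (t * x)‖ ≤ C) : ‖avg w f x‖ ≤ W * C := by
  have h0 : 0 ≤ W := (abs_nonneg _).trans (hw 0 ⟨le_rfl, zero_le_one⟩)
  have := intervalIntegral.norm_integral_le_of_norm_le_const (a := (0 : ℝ)) (b := 1)
    (f := fun t => w t • f (t * x)) (C := W * C) fun t ht => by
      rw [uIoc_of_le zero_le_one] at ht
      rw [norm_smul]
      exact mul_le_mul (hw t ⟨ht.1.le, ht.2⟩) (hf t ⟨ht.1.le, ht.2⟩) (norm_nonneg _) h0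
  rwa [sub_zero, abs_one, mul_one] at this

variable [CompleteSpace E]

lemma avg_zero (w : ℝ → ℝ) (f : ℝ → E) : avg w f 0 = (∫ t in (0 : ℝ)..1, w t) • f 0 := by
  simp [avg, intervalIntegral.integral_smul_const]

lemma hasDerivAt_avg {w : ℝ → ℝ} {f f' : ℝ → E} (hw : Continuous w) (hf' : Continuous f')
    (hf : ∀ x, HasDerivAt f (f' x) x) (x : ℝ) :
    HasDerivAt (avg w f) (avg (fun t => t * w t) f' x) x := by
  have hfc : Continuous f := continuous_iff_continuousAt.2 fun x => (hf x).continuousAt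
  -- For `|y - x| < 1` and `0 < t ≤ 1` the point `t * y` stays in this interval, so `C` yields a
  -- dominating function.
  obtain ⟨C, hC⟩ := (isCompact_Icc (a := -(|x| + 1)) (b := |x| + 1)).exists_bound_of_continuousOn
    hf'.continuousOn
  refine (intervalIntegral.hasDerivAt_integral_of_dominated_loc_of_deriv_le (μ := volume)
    (F := fun x t => w t • f (t * x)) (F' := fun x t => (t * w t) • f' (t * x))
    (s := Metric.ball x 1) (bound := fun t => |t * w t| * C)
    (Metric.ball_mem_nhds x one_pos) (.of_forall fun y => ?_) ?_ ?_ ?_ ?_ ?_).2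
  · exact Continuous.aestronglyMeasurable (by fun_prop)
  · exact Continuous.intervalIntegrable (by fun_prop) _ _
  · exact Continuous.aestronglyMeasurable (by fun_prop)
  · refine .of_forall fun t ht y hy => ?_
    rw [uIoc_of_le zero_le_one] at ht
    rw [norm_smul, Real.norm_eq_abs]
    refine mul_le_mul_of_nonneg_left (hC _ (abs_le.1 ?_)) (abs_nonneg _)
    rw [Metric.mem_ball, Real.dist_eq] at hy
    have h1 : |y| ≤ |x| + 1 := by
      have := abs_sub_abs_le_abs_sub y x
      linarith
    rw [abs_mul, abs_of_pos ht.1]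
    nlinarith [ht.1, ht.2, abs_nonneg y]
  · exact Continuous.intervalIntegrable (by fun_prop) _ _
  · refine .of_forall fun t _ y _ => ?_
    have h1 : HasDerivAt (fun y : ℝ => t * y) t y := by
      simpa using (hasDerivAt_id y).const_mul t
    have := ((hf (t * y)).scomp y h1).const_smul (w t)
    rw [smul_smul, mul_comm] at this
    exact this

/-- A function which is continuously differentiable on `B1` is the restriction of a function which
is continuously differentiable on the line. -/
lemma exists_extension {f f' : ℝ → E} (hf' : ContinuousOn f' B1)
    (hf : ∀ x ∈ B1, HasDerivWithinAt f (f' x) B1 x) :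
    ∃ g : ℝ → E, (∀ x, HasDerivAt g (clamp f' x) x) ∧ EqOn g f B1 := by
  have hc := continuous_clamp hf'
  have hg : ∀ x, HasDerivAt (fun x => f 0 + ∫ s in (0 : ℝ)..x, clamp f' s) (clamp f' x) x :=
    fun x => (intervalIntegral.integral_hasDerivAt_right (hc.intervalIntegrable _ _)
      hc.aestronglyMeasurable.stronglyMeasurableAtFilter hc.continuousAt).const_add _
  refine ⟨_, hg, fun x hx => ?_⟩
  have h := (convex_Icc (-1 : ℝ) 1).norm_image_sub_le_of_norm_hasDerivWithin_le (C := 0)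
    (f := fun x => (f 0 + ∫ s in (0 : ℝ)..x, clamp f' s) - f x) (f' := fun _ => 0)
    (fun y hy => by
      have := (hg y).hasDerivWithinAt.sub (hf y hy)
      rw [clamp_eq f' hy, sub_self] at this
      exact this)
    (by simp) zero_mem_B1 hx
  simpa [sub_eq_zero] using h

/-- Differentiation under the integral needs a full neighbourhood of the point, hence the passage to
an extension; the radial average at a point of `B1` sees only values on `B1`. -/
lemma hasDerivWithinAt_avg {w : ℝ → ℝ} {f f' : ℝ → E} (hw : Continuous w)
    (hf' : ContinuousOn f' B1) (hf : ∀ x ∈ B1, HasDerivWithinAt f (f' x) B1 x) {x : ℝ}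
    (hx : x ∈ B1) : HasDerivWithinAt (avg w f) (avg (fun t => t * w t) f' x) B1 x := by
  obtain ⟨g, hg, hgf⟩ := exists_extension hf' hf
  have h := (hasDerivAt_avg hw (continuous_clamp hf') hg x).hasDerivWithinAt (s := B1)
  rw [avg_congr (fun _ hy => clamp_eq f' hy) hx] at h
  exact h.congr (avg_congr hgf.symm) (avg_congr hgf.symm hx)

/-- Hadamard's lemma: the quotient `(f x - f 0) / x` is an average of `f'`, so it is regular at `0`
at the cost of one derivative. -/
lemma smul_avg_one {f f' : ℝ → E} (hf' : Continuous f') (hf : ∀ x, HasDerivAt f (f' x) x) (x : ℝ) :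
    x • avg (fun _ => 1) f' x = f x - f 0 := by
  have : ∀ t ∈ uIcc (0 : ℝ) 1, HasDerivAt (fun t => f (t * x)) (x • f' (t * x)) t := fun t _ => by
    have h1 : HasDerivAt (fun y : ℝ => y * x) x t := by
      simpa using (hasDerivAt_id t).mul_const x
    exact (hf (t * x)).scomp t h1
  have h := intervalIntegral.integral_eq_sub_of_hasDerivAt this
    (Continuous.intervalIntegrable (by fun_prop) _ _)
  rw [intervalIntegral.integral_smul] at h
  simpa [avg] using h

lemma smul_avg_one_of_mem {f f' : ℝ → E} (hf' : ContinuousOn f' B1)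
    (hf : ∀ x ∈ B1, HasDerivWithinAt f (f' x) B1 x) {x : ℝ} (hx : x ∈ B1) :
    x • avg (fun _ => 1) f' x = f x - f 0 := by
  obtain ⟨g, hg, hgf⟩ := exists_extension hf' hf
  have h := smul_avg_one (continuous_clamp hf') hg x
  rwa [avg_congr (fun _ hy => clamp_eq f' hy) hx, hgf hx, hgf zero_mem_B1] at h

end Averaging

/-! ### Families with common `C^n` bounds and their stability. -/

section Families

variable {E : Type*} [NormedAddCommGroup E] [NormedSpace ℝ E] {ι : Type*}

/-- A family of continuous functions on `B1` with a common bound. -/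
def UniformlyBounded (F : ι → ℝ → E) : Prop :=
  (∀ i, ContinuousOn (F i) B1) ∧ ∃ C, ∀ i, ∀ x ∈ B1, ‖F i x‖ ≤ C

/-- A family of functions of class `C^n` on `B1` with common bounds for the derivatives of order at
most `n`. -/
def UniformCk : ℕ → (ι → ℝ → E) → Prop
  | 0, F => UniformlyBounded F
  | n + 1, F => UniformlyBounded F ∧ (∀ i, DifferentiableOn ℝ (F i) B1) ∧
      UniformCk n fun i => derivWithin (F i) B1

namespace UniformCk

lemma bounded {n : ℕ} {F : ι → ℝ → E} (h : UniformCk n F) : UniformlyBounded F := by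
  cases n with
  | zero => exact h
  | succ n => exact h.1

lemma continuousOn {n : ℕ} {F : ι → ℝ → E} (h : UniformCk n F) (i : ι) : ContinuousOn (F i) B1 :=
  h.bounded.1 i

lemma exists_bound {n : ℕ} {F : ι → ℝ → E} (h : UniformCk n F) :
    ∃ C, 0 ≤ C ∧ ∀ i, ∀ x ∈ B1, ‖F i x‖ ≤ C := by
  obtain ⟨C, hC⟩ := h.bounded.2
  exact ⟨max C 0, le_max_right _ _, fun i x hx => (hC i x hx).trans (le_max_left _ _)⟩

lemma derivFamily {n : ℕ} {F : ι → ℝ → E} (h : UniformCk (n + 1) F) :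
    UniformCk n fun i => derivWithin (F i) B1 := h.2.2

lemma hasDerivWithinAt {n : ℕ} {F : ι → ℝ → E} (h : UniformCk (n + 1) F) (i : ι) {x : ℝ}
    (hx : x ∈ B1) : HasDerivWithinAt (F i) (derivWithin (F i) B1 x) B1 x :=
  (h.2.1 i x hx).hasDerivWithinAt

lemma pred {n : ℕ} {F : ι → ℝ → E} (h : UniformCk (n + 1) F) : UniformCk n F := by
  induction n generalizing F with
  | zero => exact h.1
  | succ n ih => exact ⟨h.1, h.2.1, ih h.2.2⟩

lemma congr {n : ℕ} {F G : ι → ℝ → E} (h : UniformCk n F) (hFG : ∀ i, EqOn (F i) (G i) B1) :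
    UniformCk n G := by
  have key : ∀ {F G : ι → ℝ → E}, UniformlyBounded F → (∀ i, EqOn (F i) (G i) B1) →
      UniformlyBounded G := fun hF hFG =>
    ⟨fun i => (hF.1 i).congr (hFG i).symm, hF.2.imp fun C hC i x hx => by
      rw [← hFG i hx]; exact hC i x hx⟩
  induction n generalizing F G with
  | zero => exact key h hFG
  | succ n ih =>
    exact ⟨key h.1 hFG, fun i => (h.2.1 i).congr (hFG i).symm,
      ih h.2.2 fun i x hx => derivWithin_congr (hFG i) (hFG i hx)⟩

/-- The introduction rule behind the closure properties: a formula for the derivative in terms of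
families already controlled lets an induction on `n` proceed. -/
lemma of_hasDerivWithinAt {n : ℕ} {F F' : ι → ℝ → E} (hF : UniformlyBounded F)
    (hF' : UniformCk n F') (h : ∀ i, ∀ x ∈ B1, HasDerivWithinAt (F i) (F' i x) B1 x) :
    UniformCk (n + 1) F :=
  ⟨hF, fun i x hx => (h i x hx).differentiableWithinAt,
    hF'.congr fun i x hx => ((h i x hx).derivWithin (uniqueDiffOn_B1 x hx)).symm⟩

lemma const (n : ℕ) {c : ι → E} {C : ℝ} (hc : ∀ i, ‖c i‖ ≤ C) :
    UniformCk n fun i (_ : ℝ) => c i := by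
  have key : ∀ (c : ι → E) (C : ℝ), (∀ i, ‖c i‖ ≤ C) → UniformlyBounded fun i (_ : ℝ) => c i :=
    fun c C hc => ⟨fun i => continuousOn_const, C, fun i x _ => hc i⟩
  induction n generalizing c C with
  | zero => exact key c C hc
  | succ n ih =>
    exact of_hasDerivWithinAt (key c C hc) (ih (c := fun _ => 0) (C := 0) (by simp))
      fun i x _ => hasDerivWithinAt_const _ _ _

lemma add {n : ℕ} {F G : ι → ℝ → E} (hF : UniformCk n F) (hG : UniformCk n G) :
    UniformCk n fun i x => F i x + G i x := by
  have key : ∀ {F G : ι → ℝ → E}, UniformlyBounded F → UniformlyBounded G →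
      UniformlyBounded fun i x => F i x + G i x := by
    rintro F G ⟨h1, C, hC⟩ ⟨h2, D, hD⟩
    exact ⟨fun i => (h1 i).add (h2 i), C + D, fun i x hx =>
      (norm_add_le _ _).trans (add_le_add (hC i x hx) (hD i x hx))⟩
  induction n generalizing F G with
  | zero => exact key hF hG
  | succ n ih =>
    exact of_hasDerivWithinAt (key hF.1 hG.1) (ih hF.2.2 hG.2.2)
      fun i x hx => (hF.hasDerivWithinAt i hx).add (hG.hasDerivWithinAt i hx)

lemma smul {n : ℕ} {F : ι → ℝ → ℝ} {G : ι → ℝ → E} (hF : UniformCk n F) (hG : UniformCk n G) :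
    UniformCk n fun i x => F i x • G i x := by
  have key : ∀ {F : ι → ℝ → ℝ} {G : ι → ℝ → E}, UniformlyBounded F → UniformlyBounded G →
      UniformlyBounded fun i x => F i x • G i x := by
    rintro F G ⟨h1, C, hC⟩ ⟨h2, D, hD⟩
    refine ⟨fun i => (h1 i).smul (h2 i), C * D, fun i x hx => ?_⟩
    rw [norm_smul]
    exact mul_le_mul (hC i x hx) (hD i x hx) (norm_nonneg _) ((norm_nonneg _).trans (hC i x hx))
  induction n generalizing F G with
  | zero => exact key hF hG
  | succ n ih =>
    exact of_hasDerivWithinAt (key hF.1 hG.1) ((ih hF.pred hG.2.2).add (ih hF.2.2 hG.pred))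
      fun i x hx => (hF.hasDerivWithinAt i hx).smul (hG.hasDerivWithinAt i hx)

lemma mul {n : ℕ} {F G : ι → ℝ → ℝ} (hF : UniformCk n F) (hG : UniformCk n G) :
    UniformCk n fun i x => F i x * G i x := hF.smul hG

lemma sub {n : ℕ} {F G : ι → ℝ → E} (hF : UniformCk n F) (hG : UniformCk n G) :
    UniformCk n fun i x => F i x - G i x := by
  have h := hF.add ((const n (c := fun _ : ι => (-1 : ℝ)) (C := 1) (by simp)).smul hG)
  exact h.congr fun i x _ => by simp [sub_eq_add_neg]

lemma identity (n : ℕ) : UniformCk n fun (_ : ι) (x : ℝ) => x := by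
  have key : UniformlyBounded fun (_ : ι) (x : ℝ) => x :=
    ⟨fun _ => continuousOn_id, 1, fun _ x hx => abs_le.2 hx⟩
  cases n with
  | zero => exact key
  | succ n =>
    exact of_hasDerivWithinAt key (const n (c := fun _ => (1 : ℝ)) (C := 1) (by simp))
      fun i x _ => hasDerivWithinAt_id _ _

/-- The compact set `K` contains the values of all members at once; this makes the bounds on the
derivatives of `f` common to the family. -/
lemma comp {n : ℕ} {F : ι → ℝ → ℝ} {f : ℝ → ℝ} {U K : Set ℝ} (hU : IsOpen U) (hK : IsCompact K)
    (hKU : K ⊆ U) (hf : ContDiffOn ℝ ∞ f U) (hFK : ∀ i, ∀ x ∈ B1, F i x ∈ K)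
    (hF : UniformCk n F) : UniformCk n fun i x => f (F i x) := by
  have key : ∀ f : ℝ → ℝ, ContDiffOn ℝ ∞ f U → UniformlyBounded fun i x => f (F i x) := by
    intro f hf
    obtain ⟨C, hC⟩ := hK.exists_bound_of_continuousOn (hf.continuousOn.mono hKU)
    exact ⟨fun i => (hf.continuousOn.mono hKU).comp (hF.continuousOn i) fun x hx => hFK i x hx,
      C, fun i x hx => hC _ (hFK i x hx)⟩
  induction n generalizing f with
  | zero => exact key f hf
  | succ n ih =>
    have hd : ContDiffOn ℝ ∞ (deriv f) U := hf.deriv_of_isOpen hU (by simp)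
    refine of_hasDerivWithinAt (key f hf) ((ih hd hF.pred).mul hF.2.2) fun i x hx => ?_
    have h1 : HasDerivAt f (deriv f (F i x)) (F i x) :=
      ((hf.differentiableOn (by simp)).differentiableAt
        (hU.mem_nhds (hKU (hFK i x hx)))).hasDerivAt
    exact h1.comp_hasDerivWithinAt x (hF.hasDerivWithinAt i hx)

lemma average [CompleteSpace E] {n : ℕ} {F : ι → ℝ → E} {w : ℝ → ℝ} (hw : Continuous w)
    (hF : UniformCk n F) : UniformCk n fun i => avg w (F i) := by
  have key : ∀ {F : ι → ℝ → E} {w : ℝ → ℝ}, Continuous w → UniformlyBounded F →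
      UniformlyBounded fun i => avg w (F i) := by
    rintro F w hw ⟨h1, C, hC⟩
    obtain ⟨W, hW⟩ := (isCompact_Icc (a := (0 : ℝ)) (b := 1)).exists_bound_of_continuousOn
      hw.continuousOn
    exact ⟨fun i => continuousOn_avg hw (h1 i), W * C, fun i x hx =>
      norm_avg_le hW fun t ht => hC i _ (mul_mem_B1 ht hx)⟩
  induction n generalizing F w with
  | zero => exact key hw hF
  | succ n ih =>
    exact of_hasDerivWithinAt (key hw hF.1)
      -- Each derivative in `x` produces a factor `t`, so the induction has to run over all weights.
      (ih (w := fun t => t * w t) (continuous_id.mul hw) hF.2.2) fun i x hx =>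
      hasDerivWithinAt_avg hw (hF.2.2.continuousOn i) (fun x hx => hF.hasDerivWithinAt i hx) hx

lemma contDiffOn {n : ℕ} {F : ι → ℝ → E} (hF : UniformCk n F) (i : ι) :
    ContDiffOn ℝ n (F i) B1 := by
  induction n generalizing F with
  | zero => exact contDiffOn_zero.2 (hF.continuousOn i)
  | succ n ih =>
    have := (contDiffOn_succ_iff_derivWithin (𝕜 := ℝ) (n := n) (f := F i) uniqueDiffOn_B1).2
      ⟨hF.2.1 i, by simp, ih hF.2.2⟩
    exact_mod_cast this

lemma of_contDiffOn {n : ℕ} {F : ι → ℝ → E} (hF : ∀ i, ContDiffOn ℝ n (F i) B1)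
    (h : ∀ k ≤ n, ∃ C, ∀ i, ∀ x ∈ B1, ‖iteratedDerivWithin k (F i) B1 x‖ ≤ C) :
    UniformCk n F := by
  have key : ∀ {m : ℕ} {F : ι → ℝ → E}, (∀ i, ContDiffOn ℝ m (F i) B1) →
      (∃ C, ∀ i, ∀ x ∈ B1, ‖iteratedDerivWithin 0 (F i) B1 x‖ ≤ C) → UniformlyBounded F := by
    intro m F hF h
    exact ⟨fun i => (hF i).continuousOn, by simpa using h⟩
  induction n generalizing F with
  | zero => exact key hF (h 0 le_rfl)
  | succ n ih =>
    have hs := fun i => (contDiffOn_succ_iff_derivWithin (𝕜 := ℝ) (n := n) (f := F i)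
      uniqueDiffOn_B1).1 (by exact_mod_cast hF i)
    refine ⟨key hF (h 0 (Nat.zero_le _)), fun i => (hs i).1, ih (fun i => (hs i).2.2) ?_⟩
    intro k hk
    obtain ⟨C, hC⟩ := h (k + 1) (by omega)
    refine ⟨C, fun i x hx => ?_⟩
    rw [← iteratedDerivWithin_succ']
    exact hC i x hx

end UniformCk

end Families

/-! ### The truncated Fresnel integral against the complete one. -/

section Fresnel

open Filter Topology

/-- A smooth cutoff, equal to `1` near the origin and supported in `[-3/10, 3/10]`. -/
def cutoff : ContDiffBump (0 : ℝ) := ⟨1 / 10, 3 / 10, by norm_num, by norm_num⟩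

lemma contDiff_cutoff : ContDiff ℝ ∞ (cutoff : ℝ → ℝ) := cutoff.contDiff

lemma cutoff_zero : cutoff (0 : ℝ) = 1 :=
  cutoff.one_of_mem_closedBall (Metric.mem_closedBall_self cutoff.rIn_pos.le)

lemma cutoff_eq_zero {s : ℝ} (hs : 3 / 10 ≤ |s|) : cutoff s = 0 :=
  cutoff.zero_of_le_dist (by rw [Real.dist_eq, sub_zero]; exact hs)

/-- The truncated Fresnel integral. -/
def fresnel (lam : ℝ) : ℂ :=
  ∫ s : ℝ, Complex.exp (Complex.I * ((lam * (s ^ 2 / 2) : ℝ) : ℂ)) * ((cutoff s : ℝ) : ℂ)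

/-- Smooth functions which vanish near the origin and are a multiple of `s⁻ʲ` for `|s| > 1`. -/
def HasPowerTail (j : ℕ) (h : ℝ → ℝ) : Prop :=
  ContDiff ℝ ∞ h ∧ (∃ c : ℝ, ∀ s, 1 < |s| → h s = c * (s ^ j)⁻¹) ∧ ∀ s, |s| < 1 / 10 → h s = 0

namespace HasPowerTail

lemma isOpen_lt_abs (a : ℝ) : IsOpen {s : ℝ | a < |s|} := isOpen_lt continuous_const continuous_abs

/-- Vanishing near the origin is what keeps the division by `s` smooth. -/
lemma div_id {j : ℕ} {h : ℝ → ℝ} (H : HasPowerTail j h) :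
    HasPowerTail (j + 1) fun s => h s / s := by
  obtain ⟨h1, ⟨c, hc⟩, h0⟩ := H
  refine ⟨contDiff_iff_contDiffAt.2 fun s => ?_, ⟨c, fun s hs => ?_⟩, fun s hs => ?_⟩
  · by_cases hs : s = 0
    · have : (fun s => h s / s) =ᶠ[𝓝 s] fun _ => 0 := by
        have : {s : ℝ | |s| < 1 / 10} ∈ 𝓝 s :=
          (isOpen_lt continuous_abs continuous_const).mem_nhds (by simp [hs])
        filter_upwards [this] with t ht
        simp [h0 t ht]
      exact contDiffAt_const.congr_of_eventuallyEq this
    · exact h1.contDiffAt.div contDiffAt_id hs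
  · simp only [hc s hs, pow_succ, mul_inv, div_eq_mul_inv, mul_assoc]
  · simp [h0 s hs]

lemma deriv {j : ℕ} {h : ℝ → ℝ} (H : HasPowerTail j h) : HasPowerTail (j + 1) (deriv h) := by
  obtain ⟨h1, ⟨c, hc⟩, h0⟩ := H
  refine ⟨h1.deriv' , ⟨-j * c, fun s hs => ?_⟩, fun s hs => ?_⟩
  · have he : h =ᶠ[𝓝 s] fun s => c * (s ^ j)⁻¹ := by
      filter_upwards [(isOpen_lt_abs 1).mem_nhds hs] with t ht using hc t ht
    have hs0 : s ≠ 0 := by rintro rfl; simp at hs; linarith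
    rw [he.deriv_eq]
    have := ((hasDerivAt_pow j s).inv (pow_ne_zero j hs0)).const_mul c
    refine (this.deriv).trans ?_
    cases j with
    | zero => simp
    | succ j => field_simp; simp; ring
  · have he : h =ᶠ[𝓝 s] fun s => 0 := by
      filter_upwards [(isOpen_lt continuous_abs continuous_const).mem_nhds hs] with t ht
        using h0 t ht
    rw [he.deriv_eq]
    simp

lemma exists_bound {j : ℕ} {h : ℝ → ℝ} (H : HasPowerTail j h) : ∃ C, ∀ s, |h s| ≤ C := by
  obtain ⟨h1, ⟨c, hc⟩, -⟩ := H
  obtain ⟨C, hC⟩ := (isCompact_Icc (a := (-1 : ℝ)) (b := 1)).exists_bound_of_continuousOn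
    h1.continuous.continuousOn
  refine ⟨max C |c|, fun s => ?_⟩
  rcases le_or_gt |s| 1 with hs | hs
  · exact (hC s (abs_le.1 hs)).trans (le_max_left _ _)
  · refine le_trans ?_ (le_max_right _ _)
    rw [hc s hs, abs_mul, abs_inv, abs_pow]
    exact mul_le_of_le_one_right (abs_nonneg _) (inv_le_one_of_one_le₀ (one_le_pow₀ hs.le))

lemma integrable {j : ℕ} {h : ℝ → ℝ} (H : HasPowerTail j h) (hj : 2 ≤ j) : Integrable h := by
  have hcont : Continuous h := H.1.continuous
  obtain ⟨h1, ⟨c, hc⟩, -⟩ := H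
  obtain ⟨C, hC⟩ := (isCompact_Icc (a := (-1 : ℝ)) (b := 1)).exists_bound_of_continuousOn
    (f := fun s => h s * (1 + s ^ 2)) (by fun_prop)
  refine (integrable_inv_one_add_sq.const_mul (max C (|c| * 2))).mono'
    hcont.aestronglyMeasurable (.of_forall fun s => ?_)
  have hp : 0 < 1 + s ^ 2 := by positivity
  rw [← div_eq_mul_inv, le_div_iff₀ hp]
  rcases le_or_gt |s| 1 with hs | hs
  · have := hC s (abs_le.1 hs)
    rw [norm_mul, Real.norm_of_nonneg hp.le] at this
    exact this.trans (le_max_left _ _)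
  · refine le_trans ?_ (le_max_right _ _)
    rw [hc s hs, Real.norm_eq_abs, abs_mul, abs_inv, abs_pow, mul_assoc]
    refine mul_le_mul_of_nonneg_left ?_ (abs_nonneg _)
    have h2 : |s| ^ 2 ≤ |s| ^ j := pow_le_pow_right₀ hs.le hj
    have h3 : 1 ≤ |s| ^ 2 := one_le_pow₀ hs.le
    have h4 : s ^ 2 = |s| ^ 2 := (sq_abs s).symm
    rw [inv_mul_le_iff₀ (by positivity), h4]
    linarith

end HasPowerTail

lemma hasDerivAt_gaussian (b : ℂ) (s : ℝ) :
    HasDerivAt (fun s : ℝ => Complex.exp (-b * (s : ℂ) ^ 2))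
      (-(2 * b) * ((s : ℂ) * Complex.exp (-b * (s : ℂ) ^ 2))) s := by
  have h1 : HasDerivAt (fun s : ℝ => (s : ℂ)) 1 s := Complex.ofRealCLM.hasDerivAt
  have h2 : HasDerivAt (fun s : ℝ => Complex.exp (-b * (s : ℂ) ^ 2)) _ s :=
    ((h1.pow 2).const_mul (-b)).cexp
  refine h2.congr_deriv ?_
  simp only [Pi.pow_apply, Nat.cast_ofNat, Nat.add_one_sub_one, pow_one]
  ring

/-- Since `s e^(-b s²)` is `-(2b)⁻¹` times a derivative, writing `h = s * (h / s)` and integrating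
by parts gains a factor `(2b)⁻¹`. The new amplitude `(h / s)'` decays two powers faster. -/
lemma HasPowerTail.integral_gaussian_mul {j : ℕ} {h : ℝ → ℝ} (H : HasPowerTail j h) {b : ℂ}
    (hb : 0 < b.re) : ∫ s : ℝ, Complex.exp (-b * (s : ℂ) ^ 2) * (h s : ℂ) =
      (2 * b)⁻¹ * ∫ s : ℝ, Complex.exp (-b * (s : ℂ) ^ 2) *
        ((_root_.deriv (fun s => h s / s) s : ℝ) : ℂ) := by
  have H1 := H.div_id
  have H2 := H1.deriv
  have hb0 : 2 * b ≠ 0 := by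
    intro h0
    have : b = 0 := by simpa using h0
    simp [this] at hb
  obtain ⟨C1, hC1⟩ := H1.exists_bound
  obtain ⟨C2, hC2⟩ := H2.exists_bound
  set k := fun s => h s / s with hk
  have hk1 : ∀ s, HasDerivAt (fun s => (k s : ℂ)) ((_root_.deriv k s : ℝ) : ℂ) s := fun s =>
    (H1.1.differentiable (by simp) s).hasDerivAt.ofReal_comp
  have kc : Continuous fun s => (k s : ℂ) := Complex.continuous_ofReal.comp H1.1.continuous
  have kc' : Continuous fun s => ((_root_.deriv k s : ℝ) : ℂ) :=
    Complex.continuous_ofReal.comp H2.1.continuous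
  have hi1 := (integrable_cexp_neg_mul_sq hb)
  have hi2 := (integrable_mul_cexp_neg_mul_sq hb)
  have key := integral_mul_deriv_eq_deriv_mul_of_integrable
    (u := fun s => (k s : ℂ)) (v := fun s : ℝ => Complex.exp (-b * (s : ℂ) ^ 2))
    (fun s _ => hk1 s) (fun s _ => hasDerivAt_gaussian b s)
    ((hi2.const_mul (-(2 * b))).bdd_mul (c := C1) kc.aestronglyMeasurable
      (.of_forall fun s => by simpa using hC1 s))
    (hi1.bdd_mul (c := C2) kc'.aestronglyMeasurable (.of_forall fun s => by simpa using hC2 s))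
    (hi1.bdd_mul (c := C1) kc.aestronglyMeasurable (.of_forall fun s => by simpa using hC1 s))
  have e1 : (fun s : ℝ => (k s : ℂ) * (-(2 * b) * ((s : ℂ) * Complex.exp (-b * (s : ℂ) ^ 2)))) =
      fun s : ℝ => -(2 * b) * (Complex.exp (-b * (s : ℂ) ^ 2) * (h s : ℂ)) := by
    ext s
    have : (k s : ℂ) * (s : ℂ) = (h s : ℂ) := by
      rw [← Complex.ofReal_mul]
      congr 1
      by_cases hs : s = 0
      · simp [hs, H.2.2 0 (by norm_num)]
      · simp [hk, hs]
    rw [← this]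
    ring
  rw [e1, integral_const_mul] at key
  simp_rw [mul_comm (Complex.exp _) ((_root_.deriv k _ : ℝ) : ℂ)]
  rw [eq_inv_mul_iff_mul_eq₀ hb0]
  linear_combination -key

lemma HasPowerTail.exists_integral_gaussian_mul {h : ℝ → ℝ} (H : HasPowerTail 0 h) (N : ℕ) :
    ∃ g, HasPowerTail (2 * N) g ∧ ∀ b : ℂ, 0 < b.re →
      ∫ s : ℝ, Complex.exp (-b * (s : ℂ) ^ 2) * (h s : ℂ) =
        ((2 * b) ^ N)⁻¹ * ∫ s : ℝ, Complex.exp (-b * (s : ℂ) ^ 2) * (g s : ℂ) := by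
  induction N with
  | zero => exact ⟨h, H, by simp⟩
  | succ N ih =>
    obtain ⟨g, hg, hgb⟩ := ih
    refine ⟨_, hg.div_id.deriv, fun b hb => ?_⟩
    rw [hgb b hb, hg.integral_gaussian_mul hb, pow_succ, mul_inv ((2 * b) ^ N), mul_assoc]

lemma hasPowerTail_cutoff : HasPowerTail 0 fun s => cutoff s - 1 := by
  refine ⟨contDiff_cutoff.sub contDiff_const, ⟨-1, fun s hs => ?_⟩, fun s hs => ?_⟩
  · simp only [cutoff_eq_zero (show 3 / 10 ≤ |s| by linarith)]
    simp
  · change cutoff s - 1 = 0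
    rw [cutoff.one_of_mem_closedBall, sub_self]
    simpa [Real.dist_eq, cutoff] using hs.le

/-- At `b = -iλ/2` the Gaussian value `(π / b)^(1/2)` has base `2πi/λ`, off the branch cut; the
argument `π/2` of `i` produces the phase `e^(iπ/4)`. -/
lemma prefactor_eq_cpow {lam : ℝ} (h : 0 < lam) :
    prefactor lam = (Real.pi / (-(lam : ℂ) * Complex.I / 2)) ^ (1 / 2 : ℂ) := by
  have hpos : 0 < 2 * Real.pi / lam := by positivity
  have h1 : (Real.pi / (-(lam : ℂ) * Complex.I / 2) : ℂ) =
      ((2 * Real.pi / lam : ℝ) : ℂ) * Complex.I := by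
    have : (lam : ℂ) ≠ 0 := by exact_mod_cast h.ne'
    push_cast
    field_simp
    simp
  have h2 : (2 * Real.pi) ^ (1 / 2 : ℝ) * lam ^ (-(1 / 2) : ℝ) =
      Real.exp (Real.log (2 * Real.pi / lam) / 2) := by
    rw [Real.rpow_neg h.le, ← div_eq_mul_inv, ← Real.div_rpow (by positivity) h.le,
      Real.rpow_def_of_pos hpos]
    ring_nf
  rw [h1, Complex.cpow_def_of_ne_zero (mul_ne_zero (by exact_mod_cast hpos.ne') Complex.I_ne_zero),
    Complex.log_ofReal_mul hpos Complex.I_ne_zero, Complex.log_I, prefactor, h2,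
    Complex.ofReal_exp, ← Complex.exp_add]
  congr 1
  push_cast
  ring

lemma continuous_fresnel_integrand (lam : ℝ) : Continuous fun s : ℝ =>
    Complex.exp (Complex.I * ((lam * (s ^ 2 / 2) : ℝ) : ℂ)) * ((cutoff s : ℝ) : ℂ) := by
  have := contDiff_cutoff.continuous
  fun_prop

lemma integrable_cutoff : Integrable fun s : ℝ => cutoff s :=
  contDiff_cutoff.continuous.integrable_of_hasCompactSupport cutoff.hasCompactSupport

lemma norm_cexp_I_mul_ofReal (t : ℝ) : ‖Complex.exp (Complex.I * (t : ℂ))‖ = 1 := by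
  rw [mul_comm, Complex.norm_exp_ofReal_mul_I]

lemma exists_fresnel_bound : ∃ C, ∀ lam, ‖fresnel lam‖ ≤ C := by
  refine ⟨∫ s, ‖cutoff s‖, fun lam => (norm_integral_le_integral_norm _).trans_eq ?_⟩
  congr 1 with s
  rw [norm_mul, norm_cexp_I_mul_ofReal, one_mul, Complex.norm_real]

/-- The difference is formally the integral of `e^(iλs²/2) (χ - 1)`, which does not converge
absolutely. A Gaussian damping `ε` makes it converge, and `N` integrations by parts give an
absolutely integrable amplitude and a bound independent of `ε`. -/
lemma exists_fresnel_sub_prefactor_bound (N : ℕ) (hN : 1 ≤ N) :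
    ∃ C, ∀ lam : ℝ, 0 < lam → ‖fresnel lam - prefactor lam‖ ≤ C * (lam ^ N)⁻¹ := by
  obtain ⟨g, hg, hgb⟩ := hasPowerTail_cutoff.exists_integral_gaussian_mul N
  have hgi := hg.integrable (by omega)
  refine ⟨∫ s, ‖g s‖, fun lam hlam => ?_⟩
  -- With this choice `e^(-b s²)` is the oscillating factor damped by `e^(-ε s² / 2)`, and `‖2 b‖ ≥
  -- λ` for every `ε`.
  let b : ℝ → ℂ := fun ε => ((ε : ℂ) - lam * Complex.I) / 2
  have hbre : ∀ ε, (b ε).re = ε / 2 := fun ε => by simp [b]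
  have hbc : Continuous b := by fun_prop
  have hb0 : b 0 = -(lam : ℂ) * Complex.I / 2 := by simp [b]
  have hnorm : ∀ ε, 0 ≤ ε → ∀ s : ℝ, ‖Complex.exp (-b ε * (s : ℂ) ^ 2)‖ ≤ 1 := by
    intro ε hε s
    rw [Complex.norm_exp, Real.exp_le_one_iff]
    have : (-b ε * (s : ℂ) ^ 2).re = -(ε / 2) * s ^ 2 := by
      rw [← Complex.ofReal_pow, Complex.re_mul_ofReal, Complex.neg_re, hbre]
    rw [this]
    nlinarith [mul_nonneg hε (sq_nonneg s)]
  have hlim1 : Tendsto (fun ε => ∫ s : ℝ, Complex.exp (-b ε * (s : ℂ) ^ 2) * ((cutoff s : ℝ) : ℂ))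
      (𝓝[>] 0) (𝓝 (fresnel lam)) := by
    refine tendsto_integral_filter_of_dominated_convergence (fun s => ‖cutoff s‖)
      (.of_forall fun ε => ?_) ?_ integrable_cutoff.norm (.of_forall fun s => ?_)
    · have := contDiff_cutoff.continuous
      exact Continuous.aestronglyMeasurable (by fun_prop)
    · filter_upwards [self_mem_nhdsWithin] with ε hε
      refine .of_forall fun s => ?_
      rw [norm_mul, Complex.norm_real]
      exact mul_le_of_le_one_left (norm_nonneg _) (hnorm ε (le_of_lt hε) s)
    · have hc : Continuous fun ε => Complex.exp (-b ε * (s : ℂ) ^ 2) * ((cutoff s : ℝ) : ℂ) := by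
        fun_prop
      have := (hc.tendsto 0).mono_left (nhdsWithin_le_nhds (s := Ioi 0))
      convert this using 4
      rw [hb0]
      push_cast
      ring
  have hlim2 : Tendsto (fun ε => (Real.pi / b ε) ^ (1 / 2 : ℂ)) (𝓝[>] 0)
      (𝓝 (prefactor lam)) := by
    have hne : b 0 ≠ 0 := by
      rw [hb0]
      have : (lam : ℂ) ≠ 0 := by exact_mod_cast hlam.ne'
      simp [this]
    have hc : ContinuousAt (fun ε => (Real.pi / b ε) ^ (1 / 2 : ℂ)) 0 := by
      refine ContinuousAt.cpow (continuousAt_const.div hbc.continuousAt hne) continuousAt_const ?_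
      right
      have : (Real.pi / b 0 : ℂ) = ((2 * Real.pi / lam : ℝ) : ℂ) * Complex.I := by
        rw [hb0]
        have : (lam : ℂ) ≠ 0 := by exact_mod_cast hlam.ne'
        push_cast
        field_simp
        simp
      rw [this]
      simp [Real.pi_ne_zero, hlam.ne']
    have := hc.tendsto.mono_left (nhdsWithin_le_nhds (s := Ioi 0))
    rwa [hb0, ← prefactor_eq_cpow hlam] at this
  refine le_of_tendsto (hlim1.sub hlim2).norm ?_
  filter_upwards [self_mem_nhdsWithin] with ε hε
  have hε : 0 < ε := hε
  have hre : 0 < (b ε).re := by rw [hbre]; linarith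
  have hcc := contDiff_cutoff.continuous
  have e : (∫ s : ℝ, Complex.exp (-b ε * (s : ℂ) ^ 2) * ((cutoff s : ℝ) : ℂ)) -
      (Real.pi / b ε) ^ (1 / 2 : ℂ) =
      ∫ s : ℝ, Complex.exp (-b ε * (s : ℂ) ^ 2) * ((cutoff s - 1 : ℝ) : ℂ) := by
    rw [← integral_gaussian_complex hre, ← integral_sub _ (integrable_cexp_neg_mul_sq hre)]
    · congr 1 with s
      push_cast
      ring
    · refine integrable_cutoff.norm.mono' (Continuous.aestronglyMeasurable (by fun_prop))
        (.of_forall fun s => ?_)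
      rw [norm_mul, Complex.norm_real]
      exact mul_le_of_le_one_left (norm_nonneg _) (hnorm ε hε.le s)
  rw [e, hgb _ hre, norm_mul, mul_comm]
  refine mul_le_mul ?_ ?_ (norm_nonneg _) (integral_nonneg fun _ => norm_nonneg _)
  · refine (norm_integral_le_integral_norm _).trans (integral_mono_of_nonneg
      (.of_forall fun _ => norm_nonneg _) hgi.norm (.of_forall fun s => ?_))
    simp only [norm_mul, Complex.norm_real]
    exact mul_le_of_le_one_left (norm_nonneg _) (hnorm ε hε.le s)
  · rw [norm_inv, norm_pow]
    refine inv_anti₀ (by positivity) (pow_le_pow_left₀ hlam.le ?_ N)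
    have := Complex.abs_im_le_norm (2 * b ε)
    have h2 : (2 * b ε).im = -lam := by simp [b]; ring
    rwa [h2, abs_neg, abs_of_pos hlam] at this

lemma norm_prefactor {lam : ℝ} (h : 0 < lam) :
    ‖prefactor lam‖ = (2 * Real.pi) ^ (1 / 2 : ℝ) * lam ^ (-(1 / 2) : ℝ) := by
  rw [prefactor, norm_mul, norm_cexp_I_mul_ofReal, mul_one, Complex.norm_real,
    Real.norm_of_nonneg (by positivity)]

/-- The truncated Fresnel integral agrees with the full one up to any power of `lam⁻¹` of order at
least `1/2`. -/
lemma exists_fresnel_sub_prefactor_rpow_bound {s : ℝ} (hs : 1 / 2 ≤ s) :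
    ∃ C, 0 ≤ C ∧ ∀ lam : ℝ, 0 < lam → ‖fresnel lam - prefactor lam‖ ≤ C * lam ^ (-s) := by
  obtain ⟨A, hA⟩ := exists_fresnel_bound
  obtain ⟨N, hN⟩ := exists_nat_ge (max s 1)
  obtain ⟨B, hB⟩ := exists_fresnel_sub_prefactor_bound N
    (by exact_mod_cast (le_max_right s 1).trans hN)
  have hA0 : 0 ≤ A := (norm_nonneg _).trans (hA 0)
  refine ⟨(A + (2 * Real.pi) ^ (1 / 2 : ℝ)) + |B|, by positivity, fun lam hlam => ?_⟩
  -- For small `λ` there is no cancellation to use: both terms are bounded separately, and `s ≥ 1/2`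
  -- absorbs the growth `λ^(-1/2)` of `prefactor`.
  rcases le_total lam 1 with h1 | h1
  · have h2 : 1 ≤ lam ^ (-s) := Real.one_le_rpow_of_pos_of_le_one_of_nonpos hlam h1 (by linarith)
    have h3 : lam ^ (-(1 / 2) : ℝ) ≤ lam ^ (-s) :=
      Real.rpow_le_rpow_of_exponent_ge hlam h1 (by linarith)
    calc ‖fresnel lam - prefactor lam‖ ≤ ‖fresnel lam‖ + ‖prefactor lam‖ := norm_sub_le _ _
      _ ≤ A * lam ^ (-s) + (2 * Real.pi) ^ (1 / 2 : ℝ) * lam ^ (-s) := by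
        rw [norm_prefactor hlam]
        refine add_le_add ((hA lam).trans (le_mul_of_one_le_right hA0 h2)) ?_
        exact mul_le_mul_of_nonneg_left h3 (by positivity)
      _ = (A + (2 * Real.pi) ^ (1 / 2 : ℝ)) * lam ^ (-s) := by ring
      _ ≤ _ := mul_le_mul_of_nonneg_right (by linarith [abs_nonneg B]) (by positivity)
  · calc ‖fresnel lam - prefactor lam‖ ≤ B * (lam ^ N)⁻¹ := hB lam hlam
      _ ≤ |B| * lam ^ (-s) := by
        refine mul_le_mul (le_abs_self _) ?_ (by positivity) (abs_nonneg _)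
        rw [← Real.rpow_natCast, ← Real.rpow_neg hlam.le]
        exact Real.rpow_le_rpow_of_exponent_le h1 (neg_le_neg ((le_max_left s 1).trans hN))
      _ ≤ _ := mul_le_mul_of_nonneg_right
        (le_add_of_nonneg_left (by positivity)) (by positivity)

end Fresnel

/-! ### Splitting an oscillatory integral at the scale of the critical point. -/

section Splitting

/-- The oscillating factor `e^{iλP(x)}`. -/
def osc (P : ℝ → ℝ) (lam x : ℝ) : ℂ := Complex.exp (Complex.I * ((lam * P x : ℝ) : ℂ))

lemma norm_osc (P : ℝ → ℝ) (lam x : ℝ) : ‖osc P lam x‖ = 1 := norm_cexp_I_mul_ofReal _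

lemma hasDerivAt_osc {P : ℝ → ℝ} {P' x : ℝ} (h : HasDerivAt P P' x) (lam : ℝ) :
    HasDerivAt (osc P lam) (osc P lam x * (Complex.I * ((lam * P' : ℝ) : ℂ))) x :=
  (((h.const_mul lam).ofReal_comp).const_mul Complex.I).cexp

/-- With `δ = λ^(-1/2)`, the part `[0, δ]` is at most `A δ^(α+1)` in absolute value. On `[δ, 1]` one
integration by parts costs `λ⁻¹` times boundary terms and an integral of `x^(α-2)`, of total size
`λ⁻¹ δ^(α-1) = δ^(α+1)`. The hypothesis `α < 1` makes the endpoint `δ` dominate. In the constant,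
`1` comes from the head, `20` from the two boundary terms and `1010 / (1 - α)` from the remaining
integral. -/
lemma norm_integral_osc_half_le {α : ℝ} (h0 : 0 ≤ α) (h1 : α < 1) {P P₁ P₂ : ℝ → ℝ}
    {f f' : ℝ → ℂ} {A lam : ℝ} (hP : ∀ x, HasDerivAt P (P₁ x) x)
    (hP₁ : ∀ x, HasDerivAt P₁ (P₂ x) x) (hP₂ : Continuous P₂)
    (hlow : ∀ x ∈ Icc (0 : ℝ) 1, x / 10 ≤ |P₁ x|) (hup : ∀ x, |P₂ x| ≤ 10)
    (hf : ContinuousOn f (Icc 0 1)) (hff' : ∀ x ∈ Ioo (0 : ℝ) 1, HasDerivAt f (f' x) x)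
    (hf' : ContinuousOn f' (Ioc 0 1)) (hfA : ∀ x ∈ Ioc (0 : ℝ) 1, ‖f x‖ ≤ A * x ^ α)
    (hfA' : ∀ x ∈ Ioc (0 : ℝ) 1, ‖f' x‖ ≤ A * x ^ (α - 1)) (hlam : 0 < lam) :
    ‖∫ x in (0 : ℝ)..1, osc P lam x * f x‖ ≤
      (21 + 1010 / (1 - α)) * A * lam ^ (-((1 + α) / 2)) := by
  have hA : 0 ≤ A := by
    have := (norm_nonneg _).trans (hfA 1 ⟨one_pos, le_rfl⟩)
    simpa using this
  have hα : 0 < 1 - α := by linarith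
  have hosc : Continuous (osc P lam) :=
    continuous_iff_continuousAt.2 fun x => (hasDerivAt_osc (hP x) lam).continuousAt
  have hP₁c : Continuous P₁ := continuous_iff_continuousAt.2 fun x => (hP₁ x).continuousAt
  have hint : ∀ a b : ℝ, a ∈ Icc (0 : ℝ) 1 → b ∈ Icc (0 : ℝ) 1 →
      IntervalIntegrable (fun x => osc P lam x * f x) volume a b := fun a b ha hb =>
    ((hosc.continuousOn.mul hf).mono (ordConnected_Icc.uIcc_subset ha hb)).intervalIntegrable
  have hC : 1 ≤ 21 + 1010 / (1 - α) := by
    have : 0 ≤ 1010 / (1 - α) := by positivity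
    linarith
  have head : ∀ δ ∈ Ioc (0 : ℝ) 1, ‖∫ x in (0 : ℝ)..δ, osc P lam x * f x‖ ≤ A * δ ^ α * δ := by
    intro δ hδ
    have := intervalIntegral.norm_integral_le_of_norm_le_const (a := (0 : ℝ)) (b := δ)
      (f := fun x => osc P lam x * f x) (C := A * δ ^ α) fun x hx => by
        rw [uIoc_of_le hδ.1.le] at hx
        rw [norm_mul, norm_osc, one_mul]
        exact (hfA x ⟨hx.1, hx.2.trans hδ.2⟩).trans
          (mul_le_mul_of_nonneg_left (Real.rpow_le_rpow hx.1.le hx.2 h0) hA)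
    rwa [sub_zero, abs_of_pos hδ.1] at this
  rcases le_total lam 1 with hl | hl
  · have h2 : 1 ≤ lam ^ (-((1 + α) / 2)) :=
      Real.one_le_rpow_of_pos_of_le_one_of_nonpos hlam hl (by linarith)
    refine (head 1 ⟨one_pos, le_rfl⟩).trans ?_
    rw [Real.one_rpow, mul_one, mul_one]
    calc A = 1 * A * 1 := by ring
      _ ≤ _ := by gcongr
  obtain ⟨δ, hδdef⟩ : ∃ δ, δ = lam ^ (-(1 / 2) : ℝ) := ⟨_, rfl⟩
  have hδ0 : 0 < δ := by rw [hδdef]; positivity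
  have hδ1 : δ ≤ 1 := by
    rw [hδdef]
    exact Real.rpow_le_one_of_one_le_of_nonpos hl (by norm_num)
  have hδl : δ ^ (α + 1) = lam ^ (-((1 + α) / 2)) := by
    rw [hδdef, ← Real.rpow_mul hlam.le]
    ring_nf
  have hδa : δ ^ (α - 1) = lam * δ ^ (α + 1) := by
    have h2 : lam * δ ^ (2 : ℝ) = 1 := by
      rw [hδdef, ← Real.rpow_mul hlam.le]
      norm_num
      rw [Real.rpow_neg_one, mul_inv_cancel₀ hlam.ne']
    have h3 : δ ^ (α + 1) = δ ^ (α - 1) * δ ^ (2 : ℝ) := by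
      rw [← Real.rpow_add hδ0]
      ring_nf
    rw [h3]
    linear_combination -(δ ^ (α - 1)) * h2
  have hsub : uIcc δ 1 ⊆ Ioc 0 1 := by
    rw [uIcc_of_le hδ1]
    exact fun x hx => ⟨hδ0.trans_le hx.1, hx.2⟩
  have hne : ∀ x ∈ Ioc (0 : ℝ) 1, (P₁ x : ℂ) ≠ 0 := fun x hx => by
    have := hlow x ⟨hx.1.le, hx.2⟩
    have h3 : 0 < |P₁ x| := lt_of_lt_of_le (by linarith [hx.1]) this
    exact_mod_cast abs_pos.1 h3
  have hinv : ∀ x ∈ Ioc (0 : ℝ) 1, ‖(P₁ x : ℂ)‖⁻¹ ≤ 10 * x ^ (-1 : ℝ) := fun x hx => by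
    rw [Complex.norm_real, Real.norm_eq_abs, Real.rpow_neg_one]
    have := inv_anti₀ (by linarith [hx.1]) (hlow x ⟨hx.1.le, hx.2⟩)
    refine this.trans_eq ?_
    rw [inv_div, div_eq_mul_inv]
  have hvA : ∀ x ∈ Ioc (0 : ℝ) 1, ‖f x / (P₁ x : ℂ)‖ ≤ 10 * A * x ^ (α - 1) := fun x hx => by
    rw [norm_div, div_eq_mul_inv]
    calc _ ≤ (A * x ^ α) * (10 * x ^ (-1 : ℝ)) :=
          mul_le_mul (hfA x hx) (hinv x hx) (by positivity) ((norm_nonneg _).trans (hfA x hx))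
      _ = _ := by rw [sub_eq_add_neg, Real.rpow_add hx.1]; ring
  set v' : ℝ → ℂ := fun x => (f' x * (P₁ x : ℂ) - f x * (P₂ x : ℂ)) / (P₁ x : ℂ) ^ 2 with hv'
  -- `1010 = 10 + 1000`: one factor `10` from `1 / P₁` in `f' / P₁`, and three from `1 / P₁ ^ 2` and
  -- `P₂` in `f P₂ / P₁ ^ 2`.
  have hv'A : ∀ x ∈ Ioc (0 : ℝ) 1, ‖v' x‖ ≤ 1010 * A * x ^ (α - 2) := fun x hx => by
    have e : v' x = f' x * (P₁ x : ℂ)⁻¹ - f x * (P₁ x : ℂ)⁻¹ * (P₁ x : ℂ)⁻¹ * (P₂ x : ℂ) := by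
      have := hne x hx
      simp only [hv']
      field_simp
    have hx0 := hx.1
    have b1 : ‖f' x * (P₁ x : ℂ)⁻¹‖ ≤ (A * x ^ (α - 1)) * (10 * x ^ (-1 : ℝ)) := by
      rw [norm_mul, norm_inv]
      exact mul_le_mul (hfA' x hx) (hinv x hx) (by positivity) ((norm_nonneg _).trans (hfA' x hx))
    have b2 : ‖f x * (P₁ x : ℂ)⁻¹ * (P₁ x : ℂ)⁻¹ * (P₂ x : ℂ)‖ ≤
        (A * x ^ α) * (10 * x ^ (-1 : ℝ)) * (10 * x ^ (-1 : ℝ)) * 10 := by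
      rw [norm_mul, norm_mul, norm_mul, norm_inv]
      gcongr
      · exact hfA x hx
      · exact hinv x hx
      · exact hinv x hx
      · simpa using hup x
    have p1 : x ^ (α - 2) = x ^ (α - 1) * x ^ (-1 : ℝ) := by
      rw [← Real.rpow_add hx0]; ring_nf
    have p2 : x ^ (α - 2) = x ^ α * x ^ (-1 : ℝ) * x ^ (-1 : ℝ) := by
      rw [← Real.rpow_add hx0, ← Real.rpow_add hx0]; ring_nf
    rw [e]
    refine (norm_sub_le _ _).trans ((add_le_add b1 b2).trans_eq ?_)
    linear_combination -(10 * A) * p1 - 1000 * A * p2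
  have hv'c : ContinuousOn v' (Ioc 0 1) := by
    have c1 : ContinuousOn (fun x => (P₁ x : ℂ)) (Ioc 0 1) := by fun_prop
    have c2 : ContinuousOn (fun x => (P₂ x : ℂ)) (Ioc 0 1) := by fun_prop
    have c3 : ContinuousOn f (Ioc 0 1) := hf.mono Ioc_subset_Icc_self
    exact ((hf'.mul c1).sub (c3.mul c2)).div (c1.pow 2) fun x hx => pow_ne_zero 2 (hne x hx)
  have ibp := intervalIntegral.integral_deriv_mul_eq_sub_of_hasDerivAt (a := δ) (b := 1)
    (u := osc P lam) (u' := fun x => osc P lam x * (Complex.I * ((lam * P₁ x : ℝ) : ℂ)))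
    (v := fun x => f x / (P₁ x : ℂ)) (v' := v') hosc.continuousOn
    (((hf.mono Ioc_subset_Icc_self).div (by fun_prop) hne).mono hsub)
    (fun x _ => hasDerivAt_osc (hP x) lam)
    (fun x hx => by
      rw [min_eq_left hδ1, max_eq_right hδ1] at hx
      have hx' : x ∈ Ioo (0 : ℝ) 1 := ⟨hδ0.trans hx.1, hx.2⟩
      exact (hff' x hx').div (hP₁ x).ofReal_comp (hne x ⟨hx'.1, hx'.2.le⟩))
    (Continuous.intervalIntegrable (by fun_prop) _ _)
    (hv'c.mono hsub).intervalIntegrable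
  have i2 : IntervalIntegrable (fun x => osc P lam x * v' x) volume δ 1 :=
    (hosc.continuousOn.mul (hv'c.mono hsub)).intervalIntegrable
  have e1 : ∫ x in δ..1, (osc P lam x * (Complex.I * ((lam * P₁ x : ℝ) : ℂ))) *
      (f x / (P₁ x : ℂ)) + osc P lam x * v' x =
      Complex.I * lam * (∫ x in δ..1, osc P lam x * f x) + ∫ x in δ..1, osc P lam x * v' x := by
    rw [← intervalIntegral.integral_const_mul, ← intervalIntegral.integral_add
      ((hint δ 1 ⟨hδ0.le, hδ1⟩ ⟨zero_le_one, le_rfl⟩).const_mul _) i2]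
    refine intervalIntegral.integral_congr fun x hx => ?_
    have := hne x (hsub hx)
    push_cast
    field_simp
  rw [e1] at ibp
  have hI2 : ‖∫ x in δ..1, osc P lam x * v' x‖ ≤ 1010 / (1 - α) * A * δ ^ (α - 1) := by
    have hle : ∀ᵐ x, x ∈ Ioc δ 1 → ‖osc P lam x * v' x‖ ≤ 1010 * A * x ^ (α - 2) :=
      .of_forall fun x hx => by
        rw [norm_mul, norm_osc, one_mul]
        exact hv'A x ⟨hδ0.trans hx.1, hx.2⟩
    have h0n : (0 : ℝ) ∉ uIcc δ 1 := fun h => (hsub h).1.false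
    refine (intervalIntegral.norm_integral_le_of_norm_le hδ1 hle
      ((intervalIntegral.intervalIntegrable_rpow (Or.inr h0n)).const_mul _)).trans ?_
    rw [intervalIntegral.integral_const_mul, integral_rpow (Or.inr ⟨by linarith, h0n⟩),
      Real.one_rpow]
    have e2 : α - 2 + 1 = -(1 - α) := by ring
    have e3 : α - 1 = -(1 - α) := by ring
    rw [e2, e3]
    have h3 : (1 - δ ^ (-(1 - α))) / -(1 - α) ≤ δ ^ (-(1 - α)) / (1 - α) := by
      rw [div_neg, ← neg_div]
      gcongr
      linarith
    calc 1010 * A * ((1 - δ ^ (-(1 - α))) / -(1 - α)) ≤ 1010 * A * (δ ^ (-(1 - α)) / (1 - α)) := by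
          gcongr
      _ = _ := by ring
  have hI : lam * ‖∫ x in δ..1, osc P lam x * f x‖ ≤
      (20 + 1010 / (1 - α)) * A * δ ^ (α - 1) := by
    have b0 : (1 : ℝ) ≤ δ ^ (α - 1) :=
      Real.one_le_rpow_of_pos_of_le_one_of_nonpos hδ0 hδ1 (by linarith)
    have b1 : ‖osc P lam 1 * (f 1 / (P₁ 1 : ℂ))‖ ≤ 10 * A * δ ^ (α - 1) := by
      rw [norm_mul, norm_osc, one_mul]
      have := hvA 1 ⟨one_pos, le_rfl⟩
      rw [Real.one_rpow] at this
      exact this.trans (by gcongr)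
    have b2 : ‖osc P lam δ * (f δ / (P₁ δ : ℂ))‖ ≤ 10 * A * δ ^ (α - 1) := by
      rw [norm_mul, norm_osc, one_mul]
      exact hvA δ ⟨hδ0, hδ1⟩
    have e : Complex.I * lam * (∫ x in δ..1, osc P lam x * f x) =
        osc P lam 1 * (f 1 / (P₁ 1 : ℂ)) - osc P lam δ * (f δ / (P₁ δ : ℂ)) -
        ∫ x in δ..1, osc P lam x * v' x := by
      linear_combination ibp
    have e' := congrArg norm e
    rw [norm_mul, norm_mul, Complex.norm_I, one_mul, Complex.norm_real,
      Real.norm_of_nonneg hlam.le] at e'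
    rw [e']
    refine (norm_sub_le _ _).trans ((add_le_add ((norm_sub_le _ _).trans (add_le_add b1 b2))
      hI2).trans_eq ?_)
    ring
  rw [hδa] at hI
  have hI' : ‖∫ x in δ..1, osc P lam x * f x‖ ≤ (20 + 1010 / (1 - α)) * A * δ ^ (α + 1) := by
    refine le_of_mul_le_mul_left (hI.trans_eq ?_) hlam
    ring
  have hh := head δ ⟨hδ0, hδ1⟩
  rw [mul_assoc, ← Real.rpow_add_one hδ0.ne'] at hh
  rw [← intervalIntegral.integral_add_adjacent_intervals
    (hint 0 δ ⟨le_rfl, zero_le_one⟩ ⟨hδ0.le, hδ1⟩) (hint δ 1 ⟨hδ0.le, hδ1⟩ ⟨zero_le_one, le_rfl⟩),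
    ← hδl]
  refine (norm_add_le _ _).trans ((add_le_add hh hI').trans_eq ?_)
  ring

/-- An oscillatory integral with a nondegenerate critical point at the origin, for an amplitude of
size `|x|^α` with a derivative of size `|x|^(α-1)`. -/
lemma norm_integral_osc_le {α : ℝ} (h0 : 0 ≤ α) (h1 : α < 1) {P P₁ P₂ : ℝ → ℝ}
    {f f' : ℝ → ℂ} {A lam : ℝ} (hP : ∀ x, HasDerivAt P (P₁ x) x)
    (hP₁ : ∀ x, HasDerivAt P₁ (P₂ x) x) (hP₂ : Continuous P₂)
    (hlow : ∀ x ∈ B1, |x| / 10 ≤ |P₁ x|) (hup : ∀ x, |P₂ x| ≤ 10)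
    (hf : ContinuousOn f B1)
    (hff' : ∀ x ∈ Ioo (-1 : ℝ) 1, x ≠ 0 → HasDerivAt f (f' x) x)
    (hf' : ContinuousOn f' (B1 \ {0})) (hfA : ∀ x ∈ B1, x ≠ 0 → ‖f x‖ ≤ A * |x| ^ α)
    (hfA' : ∀ x ∈ B1, x ≠ 0 → ‖f' x‖ ≤ A * |x| ^ (α - 1)) (hlam : 0 < lam) :
    ‖∫ x in (-1 : ℝ)..1, osc P lam x * f x‖ ≤
      (2 * (21 + 1010 / (1 - α))) * A * lam ^ (-((1 + α) / 2)) := by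
  have hosc : Continuous (osc P lam) :=
    continuous_iff_continuousAt.2 fun x => (hasDerivAt_osc (hP x) lam).continuousAt
  have hint : ∀ a b : ℝ, a ∈ B1 → b ∈ B1 →
      IntervalIntegrable (fun x => osc P lam x * f x) volume a b := fun a b ha hb =>
    ((hosc.continuousOn.mul hf).mono (ordConnected_Icc.uIcc_subset ha hb)).intervalIntegrable
  have m0 : (0 : ℝ) ∈ B1 := zero_mem_B1
  have m1 : (1 : ℝ) ∈ B1 := by constructor <;> norm_num
  have m2 : (-1 : ℝ) ∈ B1 := by constructor <;> norm_num
  have hR := norm_integral_osc_half_le h0 h1 hP hP₁ hP₂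
    (fun x hx => by
      have := hlow x ⟨by linarith [hx.1], hx.2⟩
      rwa [abs_of_nonneg hx.1] at this) hup
    (hf.mono (Icc_subset_Icc_left (by norm_num)))
    (fun x hx => hff' x ⟨by linarith [hx.1], hx.2⟩ hx.1.ne')
    (hf'.mono fun x hx => ⟨⟨by linarith [hx.1], hx.2⟩, hx.1.ne'⟩)
    (fun x hx => by
      have := hfA x ⟨by linarith [hx.1], hx.2⟩ hx.1.ne'
      rwa [abs_of_pos hx.1] at this)
    (fun x hx => by
      have := hfA' x ⟨by linarith [hx.1], hx.2⟩ hx.1.ne'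
      rwa [abs_of_pos hx.1] at this) hlam
  have hneg : ∀ x ∈ Ioc (0 : ℝ) 1, -x ∈ B1 ∧ -x ≠ 0 ∧ |(-x)| = x := fun x hx =>
    ⟨⟨by linarith [hx.2], by linarith [hx.1]⟩, by simpa using hx.1.ne', by
      rw [abs_neg, abs_of_pos hx.1]⟩
  have hL := norm_integral_osc_half_le (P := fun x => P (-x)) (P₁ := fun x => -P₁ (-x))
    (P₂ := fun x => P₂ (-x)) (f := fun x => f (-x)) (f' := fun x => -f' (-x)) h0 h1
    (fun x => by
      exact ((hP (-x)).scomp x (hasDerivAt_neg x)).congr_deriv (by simp))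
    (fun x => by
      exact ((hP₁ (-x)).scomp x (hasDerivAt_neg x)).neg.congr_deriv (by simp)) (by fun_prop)
    (fun x hx => by
      have := hlow (-x) ⟨by linarith [hx.2], by linarith [hx.1]⟩
      rwa [abs_neg, abs_of_nonneg hx.1, ← abs_neg (P₁ (-x))] at this) (fun x => hup _)
    (hf.comp continuousOn_neg fun x hx => ⟨by linarith [hx.2], by linarith [hx.1]⟩)
    (fun x hx => by
      exact ((hff' (-x) ⟨by linarith [hx.2], by linarith [hx.1]⟩
        (by simpa using hx.1.ne')).scomp x (hasDerivAt_neg x)).congr_deriv (by simp))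
    ((hf'.comp continuousOn_neg fun x hx => ⟨(hneg x hx).1, (hneg x hx).2.1⟩).neg)
    (fun x hx => by
      have := hfA (-x) (hneg x hx).1 (hneg x hx).2.1
      rwa [(hneg x hx).2.2] at this)
    (fun x hx => by
      have := hfA' (-x) (hneg x hx).1 (hneg x hx).2.1
      rwa [(hneg x hx).2.2, ← norm_neg] at this) hlam
  have e : ∫ x in (0 : ℝ)..1, osc (fun x => P (-x)) lam x * f (-x) =
      ∫ x in (-1 : ℝ)..0, osc P lam x * f x := by
    have := intervalIntegral.integral_comp_neg (a := 0) (b := 1) (fun x => osc P lam x * f x)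
    rw [neg_zero] at this
    exact this
  rw [e] at hL
  rw [← intervalIntegral.integral_add_adjacent_intervals (hint (-1) 0 m2 m0) (hint 0 1 m0 m1)]
  refine (norm_add_le _ _).trans ((add_le_add hL hR).trans_eq ?_)
  ring

end Splitting

/-! ### The Morse coordinate of a phase with continuous second derivative. -/

section Coordinate

open Filter Topology

/-- Continuous functions with values in `[1/10, 10]`, the second derivatives of phases. -/
structure IsCurvature (u : ℝ → ℝ) : Prop where
  continuous : Continuous u
  mem : ∀ x, u x ∈ Icc (1 / 10 : ℝ) 10

/-- The quotient `φ'(x) / x` for the phase with second derivative `u`. -/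
def slopeOf (u : ℝ → ℝ) : ℝ → ℝ := avg (fun _ => 1) u

/-- The quotient `2 φ(x) / x²` for the phase with second derivative `u`. -/
def quadOf (u : ℝ → ℝ) : ℝ → ℝ := avg (fun t => 2 * (1 - t)) u

/-- The phase with second derivative `u` and a critical zero at the origin. -/
def phaseOf (u : ℝ → ℝ) (x : ℝ) : ℝ := x ^ 2 / 2 * quadOf u x

/-- The coordinate `y` with `φ = y² / 2`. -/
def coord (u : ℝ → ℝ) (x : ℝ) : ℝ := x * √(quadOf u x)

/-- The derivative of `coord`. -/
def jac (u : ℝ → ℝ) (x : ℝ) : ℝ := slopeOf u x * (√(quadOf u x))⁻¹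

/-- The amplitude which becomes `cutoff` in the coordinate `coord`. -/
def refAmp (u : ℝ → ℝ) (x : ℝ) : ℝ := jac u x * cutoff (coord u x)

/-- A mean against a probability density obeys the pointwise bounds; this carries the pinching of
`φ''` over to `φ'(x) / x` and `2 φ(x) / x²`. -/
lemma avg_mem_Icc {w u : ℝ → ℝ} {a b : ℝ} (hw : Continuous w) (hw0 : ∀ t ∈ Icc (0 : ℝ) 1, 0 ≤ w t)
    (hw1 : ∫ t in (0 : ℝ)..1, w t = 1) (hu : Continuous u) (hab : ∀ x, u x ∈ Icc a b) (x : ℝ) :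
    avg w u x ∈ Icc a b := by
  have e : ∀ c : ℝ, ∫ t in (0 : ℝ)..1, w t * c = c := fun c => by
    rw [intervalIntegral.integral_mul_const, hw1, one_mul]
  constructor
  · conv_lhs => rw [← e a]
    refine intervalIntegral.integral_mono_on zero_le_one
      (Continuous.intervalIntegrable (by fun_prop) _ _)
      (Continuous.intervalIntegrable (by fun_prop) _ _) fun t ht => ?_
    exact mul_le_mul_of_nonneg_left (hab _).1 (hw0 t ht)
  · conv_rhs => rw [← e b]
    refine intervalIntegral.integral_mono_on zero_le_one
      (Continuous.intervalIntegrable (by fun_prop) _ _)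
      (Continuous.intervalIntegrable (by fun_prop) _ _) fun t ht => ?_
    exact mul_le_mul_of_nonneg_left (hab _).2 (hw0 t ht)

lemma integral_quad_weight : ∫ t in (0 : ℝ)..1, 2 * (1 - t) = 1 := by
  rw [intervalIntegral.integral_const_mul, intervalIntegral.integral_sub (by simp) (by simp)]
  simp
  norm_num

namespace IsCurvature

variable {u : ℝ → ℝ} (hu : IsCurvature u)
include hu

lemma slopeOf_mem (x : ℝ) : slopeOf u x ∈ Icc (1 / 10 : ℝ) 10 :=
  avg_mem_Icc continuous_const (fun _ _ => zero_le_one) (by simp) hu.continuous hu.mem x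

lemma quadOf_mem (x : ℝ) : quadOf u x ∈ Icc (1 / 10 : ℝ) 10 :=
  avg_mem_Icc (by fun_prop) (fun t ht => by linarith [ht.2]) integral_quad_weight
    hu.continuous hu.mem x

lemma quadOf_pos (x : ℝ) : 0 < quadOf u x := by linarith [(hu.quadOf_mem x).1]

lemma slopeOf_pos (x : ℝ) : 0 < slopeOf u x := by linarith [(hu.slopeOf_mem x).1]

lemma pos (x : ℝ) : 0 < u x := by linarith [(hu.mem x).1]

lemma sqrt_quadOf_pos (x : ℝ) : 0 < √(quadOf u x) := Real.sqrt_pos.2 (hu.quadOf_pos x)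

lemma continuous_slopeOf : Continuous (slopeOf u) := continuous_avg continuous_const hu.continuous

lemma continuous_quadOf : Continuous (quadOf u) := continuous_avg (by fun_prop) hu.continuous

lemma continuous_coord : Continuous (coord u) :=
  continuous_id.mul (Real.continuous_sqrt.comp hu.continuous_quadOf)

lemma continuous_jac : Continuous (jac u) :=
  hu.continuous_slopeOf.mul ((Real.continuous_sqrt.comp hu.continuous_quadOf).inv₀
    fun x => (hu.sqrt_quadOf_pos x).ne')

lemma continuous_refAmp : Continuous (refAmp u) :=
  hu.continuous_jac.mul (contDiff_cutoff.continuous.comp hu.continuous_coord)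

lemma slopeOf_zero : slopeOf u 0 = u 0 := by simp [slopeOf, avg_zero]

lemma quadOf_zero : quadOf u 0 = u 0 := by
  rw [quadOf, avg_zero, integral_quad_weight, one_smul]

lemma jac_zero : jac u 0 = √(u 0) := by
  rw [jac, hu.slopeOf_zero, hu.quadOf_zero, ← div_eq_mul_inv, Real.div_sqrt]

lemma refAmp_zero : refAmp u 0 = √(u 0) := by
  rw [refAmp, hu.jac_zero, coord, zero_mul, cutoff_zero, mul_one]

lemma hasDerivAt_integral (x : ℝ) : HasDerivAt (fun x => ∫ s in (0 : ℝ)..x, u s) (u x) x :=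
  intervalIntegral.integral_hasDerivAt_right (hu.continuous.intervalIntegrable _ _)
    hu.continuous.aestronglyMeasurable.stronglyMeasurableAtFilter hu.continuous.continuousAt

lemma mul_slopeOf (x : ℝ) : x * slopeOf u x = ∫ s in (0 : ℝ)..x, u s := by
  have := smul_avg_one hu.continuous hu.hasDerivAt_integral x
  rwa [smul_eq_mul, intervalIntegral.integral_same, sub_zero] at this

lemma hasDerivAt_mul_slopeOf (x : ℝ) : HasDerivAt (fun x => x * slopeOf u x) (u x) x := by
  simp_rw [hu.mul_slopeOf]
  exact hu.hasDerivAt_integral x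

lemma phaseOf_eq_integral (x : ℝ) : phaseOf u x = ∫ s in (0 : ℝ)..x, s * slopeOf u s := by
  have hc : Continuous fun s => s * slopeOf u s := continuous_id.mul hu.continuous_slopeOf
  have huc := hu.continuous
  have h1 : ∀ x, HasDerivAt (fun x => ∫ s in (0 : ℝ)..x, s * slopeOf u s) (x * slopeOf u x) x :=
    fun x => intervalIntegral.integral_hasDerivAt_right (hc.intervalIntegrable _ _)
      hc.aestronglyMeasurable.stronglyMeasurableAtFilter hc.continuousAt
  have hm : ∀ t : ℝ, HasDerivAt (fun t : ℝ => t * x) x t := fun t => by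
    simpa using (hasDerivAt_id t).mul_const x
  -- Taylor's formula with integral remainder: with `φ' = x m(x)`, the function `(1 - t) x φ'(tx) +
  -- φ(tx)` is a primitive in `t` of `(1 - t) x² u(tx)`. Continuity of `u` is enough.
  have key : ∀ t ∈ uIcc (0 : ℝ) 1, HasDerivAt
      (fun t : ℝ => (1 - t) * x * (t * x * slopeOf u (t * x)) +
        ∫ s in (0 : ℝ)..(t * x), s * slopeOf u s)
      (x ^ 2 / 2 * (2 * (1 - t) * u (t * x))) t := fun t _ => by
    have a1 : HasDerivAt (fun t : ℝ => (1 - t) * x) (-x) t := by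
      simpa using ((hasDerivAt_id t).const_sub 1).mul_const x
    have a2 : HasDerivAt (fun t : ℝ => t * x * slopeOf u (t * x)) (u (t * x) * x) t :=
      HasDerivAt.comp (h₂ := fun y => y * slopeOf u y) t (hu.hasDerivAt_mul_slopeOf (t * x)) (hm t)
    have a3 : HasDerivAt (fun t : ℝ => ∫ s in (0 : ℝ)..(t * x), s * slopeOf u s)
      (t * x * slopeOf u (t * x) * x) t :=
      HasDerivAt.comp (h₂ := fun y => ∫ s in (0 : ℝ)..y, s * slopeOf u s) t (h1 (t * x)) (hm t)
    exact ((a1.mul a2).add a3).congr_deriv (by ring)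
  have h := intervalIntegral.integral_eq_sub_of_hasDerivAt key
    (Continuous.intervalIntegrable (by fun_prop) _ _)
  rw [intervalIntegral.integral_const_mul] at h
  simpa [phaseOf, quadOf, avg] using h

lemma hasDerivAt_phaseOf (x : ℝ) : HasDerivAt (phaseOf u) (x * slopeOf u x) x := by
  have hc : Continuous fun s => s * slopeOf u s := continuous_id.mul hu.continuous_slopeOf
  rw [funext hu.phaseOf_eq_integral]
  exact intervalIntegral.integral_hasDerivAt_right (hc.intervalIntegrable _ _)
      hc.aestronglyMeasurable.stronglyMeasurableAtFilter hc.continuousAt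

lemma continuous_osc_phaseOf (lam : ℝ) : Continuous (osc (phaseOf u) lam) :=
  continuous_iff_continuousAt.2 fun x =>
    (hasDerivAt_osc (hu.hasDerivAt_phaseOf x) lam).continuousAt

lemma hasDerivAt_slopeOf {x : ℝ} (hx : x ≠ 0) :
    HasDerivAt (slopeOf u) ((u x - slopeOf u x) / x) x := by
  have h : slopeOf u =ᶠ[𝓝 x] fun x => x * slopeOf u x / x := by
    filter_upwards [isOpen_ne.mem_nhds hx] with y hy
    rw [mul_div_cancel_left₀ _ hy]
  refine (((hu.hasDerivAt_mul_slopeOf x).div (hasDerivAt_id x) hx).congr_of_eventuallyEq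
    h).congr_deriv ?_
  simp only [id]
  field_simp

lemma hasDerivAt_quadOf {x : ℝ} (hx : x ≠ 0) :
    HasDerivAt (quadOf u) (2 * (slopeOf u x - quadOf u x) / x) x := by
  have h : quadOf u =ᶠ[𝓝 x] fun x => 2 * phaseOf u x / x ^ 2 := by
    filter_upwards [isOpen_ne.mem_nhds hx] with y hy
    have : y ≠ 0 := hy
    rw [phaseOf]
    field_simp
  refine ((((hu.hasDerivAt_phaseOf x).const_mul 2).div (hasDerivAt_pow 2 x)
    (pow_ne_zero 2 hx)).congr_of_eventuallyEq h).congr_deriv ?_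
  simp only [phaseOf]
  field_simp
  push_cast
  ring

/-- As `u` is only continuous, `quadOf u` can be differentiated only off the origin. At `0` the
derivative is obtained as a limit, both `coord` and `jac` being continuous. -/
lemma hasDerivAt_coord (x : ℝ) : HasDerivAt (coord u) (jac u x) x := by
  have key : ∀ x : ℝ, x ≠ 0 → HasDerivAt (coord u) (jac u x) x := fun x hx => by
    refine ((hasDerivAt_id x).mul ((hu.hasDerivAt_quadOf hx).sqrt
      (hu.quadOf_pos x).ne')).congr_deriv ?_
    have h1 := (hu.sqrt_quadOf_pos x).ne'
    have h2 := Real.sq_sqrt (hu.quadOf_pos x).le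
    simp only [id, jac]
    field_simp
    linear_combination h2
  by_cases hx : x = 0
  · subst hx
    exact hasDerivAt_of_hasDerivAt_of_ne key hu.continuous_coord.continuousAt
      hu.continuous_jac.continuousAt
  · exact key x hx

lemma hasDerivAt_jac {x : ℝ} (hx : x ≠ 0) : HasDerivAt (jac u)
    (((u x - slopeOf u x) * (√(quadOf u x))⁻¹ -
      slopeOf u x * (slopeOf u x - quadOf u x) * (quadOf u x)⁻¹ * (√(quadOf u x))⁻¹) / x) x := by
  have h1 := (hu.sqrt_quadOf_pos x).ne'
  have h0 := (hu.quadOf_pos x).ne'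
  refine ((hu.hasDerivAt_slopeOf hx).mul (((hu.hasDerivAt_quadOf hx).sqrt h0).inv
    h1)).congr_deriv ?_
  have h2 := Real.sq_sqrt (hu.quadOf_pos x).le
  simp only [Pi.inv_apply]
  rw [h2]
  field_simp
  ring

lemma sq_coord (x : ℝ) : coord u x ^ 2 / 2 = phaseOf u x := by
  rw [coord, mul_pow, Real.sq_sqrt (hu.quadOf_pos x).le, phaseOf]
  ring

/-- `79/250` is just below `1/√10` and above the outer radius `3/10` of `cutoff`. So the image of
`B1` under `coord` covers the support of `cutoff`; moreover `19/20 * 79/250 ≥ 3/10`, which leaves a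
margin near `±1`. -/
lemma le_sqrt_quadOf (x : ℝ) : 79 / 250 ≤ √(quadOf u x) :=
  Real.le_sqrt_of_sq_le (by linarith [(hu.quadOf_mem x).1])

/-- The substitution `s = coord u x` turns the phase into `s² / 2` and absorbs the Jacobian, so the
result does not depend on `u`. -/
lemma integral_osc_mul_refAmp (lam : ℝ) :
    ∫ x in (-1 : ℝ)..1, osc (phaseOf u) lam x * ((refAmp u x : ℝ) : ℂ) = fresnel lam := by
  have h := intervalIntegral.integral_deriv_smul_comp (a := -1) (b := 1)
    (g := fun s : ℝ =>
      Complex.exp (Complex.I * ((lam * (s ^ 2 / 2) : ℝ) : ℂ)) * ((cutoff s : ℝ) : ℂ))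
    (fun x _ => hu.hasDerivAt_coord x) hu.continuous_jac.continuousOn
    (continuous_fresnel_integrand lam)
  have e : ∀ x, jac u x • ((fun s : ℝ =>
      Complex.exp (Complex.I * ((lam * (s ^ 2 / 2) : ℝ) : ℂ)) * ((cutoff s : ℝ) : ℂ)) ∘ coord u) x =
      osc (phaseOf u) lam x * ((refAmp u x : ℝ) : ℂ) := fun x => by
    simp only [Function.comp, hu.sq_coord, osc, refAmp, Complex.real_smul]
    push_cast
    ring
  simp_rw [e] at h
  rw [h, fresnel]
  refine intervalIntegral.integral_eq_integral_of_support_subset fun s hs => ?_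
  have hs' : |s| < 3 / 10 := by
    by_contra hlt
    exact hs (by simp [cutoff_eq_zero (not_lt.1 hlt)])
  have h1 := hu.le_sqrt_quadOf 1
  have h2 := hu.le_sqrt_quadOf (-1)
  rw [abs_lt] at hs'
  simp only [coord]
  constructor <;> linarith

lemma refAmp_eq_zero {x : ℝ} (hx : 19 / 20 ≤ |x|) : refAmp u x = 0 := by
  rw [refAmp, cutoff_eq_zero, mul_zero]
  rw [coord, abs_mul, abs_of_pos (hu.sqrt_quadOf_pos x)]
  nlinarith [hu.le_sqrt_quadOf x]

lemma norm_integral_osc_phaseOf_le {α : ℝ} (h0 : 0 ≤ α) (h1 : α < 1) {f f' : ℝ → ℂ} {A lam : ℝ}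
    (hf : ContinuousOn f B1) (hff' : ∀ x ∈ Ioo (-1 : ℝ) 1, x ≠ 0 → HasDerivAt f (f' x) x)
    (hf' : ContinuousOn f' (B1 \ {0})) (hfA : ∀ x ∈ B1, x ≠ 0 → ‖f x‖ ≤ A * |x| ^ α)
    (hfA' : ∀ x ∈ B1, x ≠ 0 → ‖f' x‖ ≤ A * |x| ^ (α - 1)) (hlam : 0 < lam) :
    ‖∫ x in (-1 : ℝ)..1, osc (phaseOf u) lam x * f x‖ ≤
      (2 * (21 + 1010 / (1 - α))) * A * lam ^ (-((1 + α) / 2)) :=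
  norm_integral_osc_le h0 h1 hu.hasDerivAt_phaseOf hu.hasDerivAt_mul_slopeOf hu.continuous
    (fun x _ => by
      rw [abs_mul, abs_of_pos (hu.slopeOf_pos x)]
      have := mul_le_mul_of_nonneg_left (hu.slopeOf_mem x).1 (abs_nonneg x)
      linarith)
    (fun x => by
      rw [abs_of_pos (hu.pos x)]
      exact (hu.mem x).2) hf hff' hf' hfA hfA' hlam

end IsCurvature

variable {ι : Type*} {u : ι → ℝ → ℝ} {n : ℕ}

lemma uniformCk_slopeOf (h : UniformCk n u) : UniformCk n fun i => slopeOf (u i) :=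
  h.average continuous_const

lemma uniformCk_quadOf (h : UniformCk n u) : UniformCk n fun i => quadOf (u i) :=
  h.average (by fun_prop)

lemma Icc_subset_Ioi_zero : Icc (1 / 10 : ℝ) 10 ⊆ Ioi 0 := fun x hx => by
  have := hx.1
  simp only [mem_Ioi]
  linarith

lemma uniformCk_inv_slopeOf (hu : ∀ i, IsCurvature (u i)) (h : UniformCk n u) :
    UniformCk n fun i x => (slopeOf (u i) x)⁻¹ :=
  UniformCk.comp (f := fun x => x⁻¹) isOpen_Ioi isCompact_Icc Icc_subset_Ioi_zero
    (contDiffOn_id.inv fun _ hx => ne_of_gt hx) (fun i x _ => (hu i).slopeOf_mem x)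
    (uniformCk_slopeOf h)

lemma uniformCk_sqrt_quadOf (hu : ∀ i, IsCurvature (u i)) (h : UniformCk n u) :
    UniformCk n fun i x => √(quadOf (u i) x) :=
  UniformCk.comp (f := fun x => √x) isOpen_Ioi isCompact_Icc Icc_subset_Ioi_zero
    (contDiffOn_id.sqrt fun _ hx => ne_of_gt hx) (fun i x _ => (hu i).quadOf_mem x)
    (uniformCk_quadOf h)

lemma uniformCk_jac (hu : ∀ i, IsCurvature (u i)) (h : UniformCk n u) :
    UniformCk n fun i => jac (u i) :=
  (uniformCk_slopeOf h).mul <|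
    UniformCk.comp (f := fun x => (√x)⁻¹) isOpen_Ioi isCompact_Icc Icc_subset_Ioi_zero
      ((contDiffOn_id.sqrt fun _ hx => ne_of_gt hx).inv fun _ hx => (Real.sqrt_pos.2 hx).ne')
      (fun i x _ => (hu i).quadOf_mem x) (uniformCk_quadOf h)

lemma uniformCk_refAmp (hu : ∀ i, IsCurvature (u i)) (h : UniformCk n u) :
    UniformCk n fun i => refAmp (u i) := by
  have hc : UniformCk n fun i => coord (u i) :=
    (UniformCk.identity n).mul (uniformCk_sqrt_quadOf hu h)
  obtain ⟨C, -, hC⟩ := hc.exists_bound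
  exact (uniformCk_jac hu h).mul <|
    UniformCk.comp (f := fun x => cutoff x) isOpen_univ (isCompact_Icc (a := -C) (b := C))
      (subset_univ _) contDiff_cutoff.contDiffOn (fun i x hx => abs_le.1 (hC i x hx)) hc

end Coordinate

/-! ### Subtracting the model amplitude and integrating by parts. -/

section Reduction

open Filter Topology

/-- The oscillatory integral over `B1` for the phase with second derivative `u`. -/
def oscB1 (u : ℝ → ℝ) (lam : ℝ) (f : ℝ → ℂ) : ℂ :=
  ∫ x in (-1 : ℝ)..1, osc (phaseOf u) lam x * f x

/-- The coefficient of the Fresnel integral in the stationary phase expansion. -/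
def leadCoef (u : ℝ → ℝ) (f : ℝ → ℂ) : ℂ := (√(u 0))⁻¹ • f 0

/-- The amplitude minus the multiple of `refAmp` with the same value at the origin. -/
def residual (u : ℝ → ℝ) (f : ℝ → ℂ) (x : ℝ) : ℂ := f x - refAmp u x • leadCoef u f

/-- The quotient of `residual u f` by the derivative of the phase. -/
def quotient (u : ℝ → ℝ) (f : ℝ → ℂ) (x : ℝ) : ℂ :=
  (slopeOf u x)⁻¹ • avg (fun _ => 1) (derivWithin (residual u f) B1) x

/-- The amplitude which results from `f` by one integration by parts. -/
def reduce (u : ℝ → ℝ) (f : ℝ → ℂ) : ℝ → ℂ := derivWithin (quotient u f) B1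

lemma norm_leadCoef_le {u : ℝ → ℝ} (hu : IsCurvature u) (f : ℝ → ℂ) :
    ‖leadCoef u f‖ ≤ 4 * ‖f 0‖ := by
  rw [leadCoef, norm_smul, norm_inv, Real.norm_of_nonneg (Real.sqrt_nonneg _)]
  have h : 1 / 4 ≤ √(u 0) := Real.le_sqrt_of_sq_le (by linarith [(hu.mem 0).1])
  have := inv_anti₀ (by norm_num) h
  refine mul_le_mul_of_nonneg_right (this.trans (by norm_num)) (norm_nonneg _)

lemma residual_zero {u : ℝ → ℝ} (hu : IsCurvature u) (f : ℝ → ℂ) : residual u f 0 = 0 := by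
  have : √(u 0) ≠ 0 := (Real.sqrt_pos.2 (hu.pos 0)).ne'
  rw [residual, leadCoef, hu.refAmp_zero, smul_smul, mul_inv_cancel₀ this, one_smul, sub_self]

/-- The subtraction does not touch the amplitude near `±1`; boundary conditions there are inherited
by the residual. -/
lemma residual_eq {u : ℝ → ℝ} (hu : IsCurvature u) (f : ℝ → ℂ) {x : ℝ} (hx : 19 / 20 ≤ |x|) :
    residual u f x = f x := by
  rw [residual, hu.refAmp_eq_zero hx, zero_smul, sub_zero]

lemma oscB1_eq_add_residual {u : ℝ → ℝ} (hu : IsCurvature u) (lam : ℝ) {f : ℝ → ℂ}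
    (hf : ContinuousOn f B1) :
    oscB1 u lam f = leadCoef u f * fresnel lam + oscB1 u lam (residual u f) := by
  have hc := hu.continuous_osc_phaseOf lam
  have hr := hu.continuous_refAmp
  have hsub : uIcc (-1 : ℝ) 1 = B1 := uIcc_of_le (by norm_num)
  have i1 : IntervalIntegrable (fun x => osc (phaseOf u) lam x * ((refAmp u x : ℝ) : ℂ))
      volume (-1) 1 := Continuous.intervalIntegrable (by fun_prop) _ _
  have i2 : IntervalIntegrable (fun x => osc (phaseOf u) lam x * residual u f x) volume (-1) 1 := by
    refine ContinuousOn.intervalIntegrable ?_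
    rw [hsub]
    exact hc.continuousOn.mul (hf.sub ((hr.smul continuous_const).continuousOn))
  rw [← hu.integral_osc_mul_refAmp lam, oscB1, oscB1, ← intervalIntegral.integral_const_mul,
    ← intervalIntegral.integral_add (i1.const_mul _) i2]
  refine intervalIntegral.integral_congr fun x _ => ?_
  simp only [residual, Complex.real_smul]
  ring

variable {ι : Type*} {u : ι → ℝ → ℝ} {f : ι → ℝ → ℂ} {n : ℕ}

lemma uniformCk_residual (hu : ∀ i, IsCurvature (u i)) (h : UniformCk n u) (hf : UniformCk n f) :
    UniformCk n fun i => residual (u i) (f i) := by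
  obtain ⟨C, -, hC⟩ := hf.exists_bound
  exact hf.sub ((uniformCk_refAmp hu h).smul (UniformCk.const n (C := 4 * C) fun i =>
    (norm_leadCoef_le (hu i) (f i)).trans
      (mul_le_mul_of_nonneg_left (hC i 0 zero_mem_B1) (by norm_num))))

lemma uniformCk_quotient (hu : ∀ i, IsCurvature (u i)) (h : UniformCk (n + 1) u)
    (hf : UniformCk (n + 1) f) : UniformCk n fun i => quotient (u i) (f i) :=
  (uniformCk_inv_slopeOf hu h.pred).smul
    ((uniformCk_residual hu h hf).derivFamily.average continuous_const)

/-- Two derivatives are lost, one to the Hadamard quotient and one to the integration by parts. -/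
lemma uniformCk_reduce (hu : ∀ i, IsCurvature (u i)) (h : UniformCk (n + 2) u)
    (hf : UniformCk (n + 2) f) : UniformCk n fun i => reduce (u i) (f i) :=
  (uniformCk_quotient hu h hf).derivFamily

lemma mul_slopeOf_smul_quotient (hu : ∀ i, IsCurvature (u i)) (h : UniformCk 1 u)
    (hf : UniformCk 1 f) (i : ι) {x : ℝ} (hx : x ∈ B1) :
    (x * slopeOf (u i) x) • quotient (u i) (f i) x = residual (u i) (f i) x := by
  have hr := uniformCk_residual (n := 1) hu h hf
  have := smul_avg_one_of_mem (hr.derivFamily.continuousOn i)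
    (fun x hx => hr.hasDerivWithinAt i hx) hx
  rw [residual_zero (hu i), sub_zero] at this
  rw [← this, quotient, smul_smul, mul_assoc, mul_inv_cancel₀ ((hu i).slopeOf_pos x).ne', mul_one]

/-- One integration by parts across the critical point. -/
lemma oscB1_residual (hu : ∀ i, IsCurvature (u i)) (h : UniformCk 2 u) (hf : UniformCk 2 f) (i : ι)
    (hf1 : f i 1 = 0) (hf2 : f i (-1) = 0) {lam : ℝ} (hlam : 0 < lam) :
    oscB1 (u i) lam (residual (u i) (f i)) =
      Complex.I * (lam : ℂ)⁻¹ * oscB1 (u i) lam (reduce (u i) (f i)) := by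
  have hsub : uIcc (-1 : ℝ) 1 = B1 := uIcc_of_le (by norm_num)
  have hq := uniformCk_quotient (n := 1) hu h hf
  have hmul := fun x hx => mul_slopeOf_smul_quotient hu h.pred hf.pred i (x := x) hx
  have hc := (hu i).continuous_osc_phaseOf lam
  have hs := (hu i).continuous_slopeOf
  have m1 : (1 : ℝ) ∈ B1 := by constructor <;> norm_num
  have m2 : (-1 : ℝ) ∈ B1 := by constructor <;> norm_num
  -- At `±1` the residual is `f`, which vanishes there, and `φ'` does not; so there are no boundary
  -- terms.
  have q1 : quotient (u i) (f i) 1 = 0 := by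
    have := hmul 1 m1
    rw [residual_eq (hu i) _ (by norm_num), hf1] at this
    exact (smul_eq_zero.1 this).resolve_left (by simpa using ((hu i).slopeOf_pos 1).ne')
  have q2 : quotient (u i) (f i) (-1) = 0 := by
    have := hmul (-1) m2
    rw [residual_eq (hu i) _ (by norm_num), hf2] at this
    exact (smul_eq_zero.1 this).resolve_left (by simpa using ((hu i).slopeOf_pos (-1)).ne')
  have hosc' : Continuous fun x => osc (phaseOf (u i)) lam x *
      (Complex.I * ((lam * (x * slopeOf (u i) x) : ℝ) : ℂ)) := by fun_prop
  have hred : ContinuousOn (reduce (u i) (f i)) B1 := hq.derivFamily.continuousOn i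
  have ibp := intervalIntegral.integral_deriv_mul_eq_sub_of_hasDerivWithinAt (a := -1) (b := 1)
    (u := osc (phaseOf (u i)) lam) (v := quotient (u i) (f i)) (v' := reduce (u i) (f i))
    (fun x _ => (hasDerivAt_osc ((hu i).hasDerivAt_phaseOf x) lam).hasDerivWithinAt)
    (fun x hx => by rw [hsub] at hx ⊢; exact hq.hasDerivWithinAt i hx)
    (hosc'.intervalIntegrable _ _) (ContinuousOn.intervalIntegrable (by rwa [hsub]))
  rw [q1, q2, mul_zero, mul_zero, sub_zero] at ibp
  have hr : ContinuousOn (residual (u i) (f i)) B1 := (uniformCk_residual hu h hf).continuousOn i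
  have i1 : IntervalIntegrable (fun x => osc (phaseOf (u i)) lam x * residual (u i) (f i) x)
      volume (-1) 1 := ContinuousOn.intervalIntegrable (by
        rw [hsub]; exact hc.continuousOn.mul hr)
  have i2 : IntervalIntegrable (fun x => osc (phaseOf (u i)) lam x * reduce (u i) (f i) x)
      volume (-1) 1 := ContinuousOn.intervalIntegrable (by
        rw [hsub]; exact hc.continuousOn.mul hred)
  have e : ∫ x in (-1 : ℝ)..1, osc (phaseOf (u i)) lam x *
      (Complex.I * ((lam * (x * slopeOf (u i) x) : ℝ) : ℂ)) * quotient (u i) (f i) x +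
        osc (phaseOf (u i)) lam x * reduce (u i) (f i) x =
      Complex.I * lam * oscB1 (u i) lam (residual (u i) (f i)) +
        oscB1 (u i) lam (reduce (u i) (f i)) := by
    rw [oscB1, oscB1, ← intervalIntegral.integral_const_mul,
      ← intervalIntegral.integral_add (i1.const_mul _) i2]
    refine intervalIntegral.integral_congr fun x hx => ?_
    rw [hsub] at hx
    simp only [← hmul x hx, Complex.real_smul]
    push_cast
    ring
  rw [e] at ibp
  have hl : (lam : ℂ) ≠ 0 := by exact_mod_cast hlam.ne'
  have hI := Complex.I_mul_I
  rw [eq_neg_of_add_eq_zero_right ibp]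
  field_simp
  rw [Complex.I_sq]
  ring

/-- All derivatives of `f` on `B1` vanish at the point `c`. -/
def FlatAt (f : ℝ → ℂ) (c : ℝ) : Prop := ∀ k, iteratedDerivWithin k f B1 c = 0

lemma FlatAt.apply_eq_zero {f : ℝ → ℂ} {c : ℝ} (h : FlatAt f c) : f c = 0 := by
  simpa using h 0

lemma FlatAt.smul {f : ℝ → ℂ} {v : ℝ → ℝ} {c : ℝ} (hc : c ∈ B1)
    (hv : ∀ n : ℕ, ContDiffWithinAt ℝ n v B1 c) (hf : ∀ n : ℕ, ContDiffWithinAt ℝ n f B1 c)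
    (h : FlatAt f c) : FlatAt (v • f) c := fun k => by
  rw [iteratedDerivWithin_smul hc uniqueDiffOn_B1 (hv k) (hf k)]
  exact Finset.sum_eq_zero fun j _ => by simp [h (k - j)]

/-- Vanishing of `f` at `±1` alone would not survive the differentiation in `reduce`; vanishing to
infinite order does. Near `±1` the quotient is `f / φ'`, so Leibniz' rule applies. -/
lemma FlatAt.reduce (hu : ∀ i, IsCurvature (u i)) (h : ∀ n, UniformCk n u)
    (hf : ∀ n, UniformCk n f) (i : ι) {c : ℝ} (hc : |c| = 1) (hfc : FlatAt (f i) c) :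
    FlatAt (reduce (u i) (f i)) c := by
  have hcB : c ∈ B1 := abs_le.1 hc.le
  have hm : ∀ x : ℝ, x ≠ 0 → x * slopeOf (u i) x ≠ 0 := fun x hx =>
    mul_ne_zero hx ((hu i).slopeOf_pos x).ne'
  have hc0 : c ≠ 0 := by rintro rfl; simp at hc
  have hflat : FlatAt ((fun x => (x * slopeOf (u i) x)⁻¹) • f i) c := by
    refine FlatAt.smul hcB (fun n => ?_) (fun n => (hf n).contDiffOn i c hcB) hfc
    exact ((contDiffWithinAt_id).mul ((uniformCk_slopeOf (h n)).contDiffOn i c hcB)).inv (hm c hc0)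
  have hgerm : quotient (u i) (f i) =ᶠ[𝓝[B1] c] (fun x => (x * slopeOf (u i) x)⁻¹) • f i := by
    have hn : {x : ℝ | 19 / 20 < |x|} ∈ 𝓝 c :=
      (isOpen_lt continuous_const continuous_abs).mem_nhds
        (by rw [mem_ofPred_eq, hc]; norm_num)
    filter_upwards [self_mem_nhdsWithin, mem_nhdsWithin_of_mem_nhds hn] with x hx hx'
    have hx0 : x ≠ 0 := by rintro rfl; simp at hx'; linarith
    have h1 := mul_slopeOf_smul_quotient hu (h 1) (hf 1) i hx
    rw [residual_eq (hu i) _ (le_of_lt hx')] at h1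
    rw [Pi.smul_apply', ← h1, inv_smul_smul₀ (hm x hx0)]
  intro k
  rw [StationaryPhase.reduce, ← iteratedDerivWithin_succ',
    hgerm.iteratedDerivWithin_eq (hgerm.self_of_nhdsWithin hcB)]
  exact hflat (k + 1)

lemma uniformCk_iterate_reduce (hu : ∀ i, IsCurvature (u i)) (h : ∀ n, UniformCk n u)
    (hf : ∀ n, UniformCk n f) (N n : ℕ) : UniformCk n fun i => (reduce (u i))^[N] (f i) := by
  induction N generalizing n with
  | zero => exact hf n
  | succ N ih =>
    simp only [Function.iterate_succ_apply']
    exact uniformCk_reduce hu (h _) (ih _)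

lemma flatAt_iterate_reduce (hu : ∀ i, IsCurvature (u i)) (h : ∀ n, UniformCk n u)
    (hf : ∀ n, UniformCk n f) (i : ι) {c : ℝ} (hc : |c| = 1) (hfc : FlatAt (f i) c) (N : ℕ) :
    FlatAt ((reduce (u i))^[N] (f i)) c := by
  induction N with
  | zero => exact hfc
  | succ N ih =>
    rw [Function.iterate_succ_apply']
    exact FlatAt.reduce (f := fun i => (StationaryPhase.reduce (u i))^[N] (f i)) hu h
      (uniformCk_iterate_reduce hu h hf N) i hc ih

/-- The stationary phase expansion with the truncated Fresnel integral. -/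
lemma oscB1_eq_sum (hu : ∀ i, IsCurvature (u i)) (h : ∀ n, UniformCk n u)
    (hf : ∀ n, UniformCk n f) (i : ι) (hf1 : FlatAt (f i) 1) (hf2 : FlatAt (f i) (-1)) {lam : ℝ}
    (hlam : 0 < lam) (N : ℕ) :
    oscB1 (u i) lam (f i) =
      (∑ k ∈ Finset.range N, (Complex.I * (lam : ℂ)⁻¹) ^ k *
        leadCoef (u i) ((reduce (u i))^[k] (f i))) * fresnel lam +
      (Complex.I * (lam : ℂ)⁻¹) ^ N * oscB1 (u i) lam ((reduce (u i))^[N] (f i)) := by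
  induction N with
  | zero => simp
  | succ N ih =>
    have hN := uniformCk_iterate_reduce hu h hf N
    rw [ih, oscB1_eq_add_residual (hu i) lam ((hN 0).continuousOn i),
      oscB1_residual (f := fun i => (reduce (u i))^[N] (f i)) hu (h 2) (hN 2) i
        (flatAt_iterate_reduce hu h hf i (by simp) hf1 N).apply_eq_zero
        (flatAt_iterate_reduce hu h hf i (by simp) hf2 N).apply_eq_zero hlam,
      Finset.sum_range_succ, Function.iterate_succ_apply']
    ring

end Reduction

/-! ### From phases and amplitudes on `B1` to curvatures and oscillatory integrals. -/

section Translation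

open Filter Topology

lemma hasDerivWithinAt_dB {E : Type*} [NormedAddCommGroup E] [NormedSpace ℝ E] {f : ℝ → E}
    {n : WithTop ℕ∞} (hf : ContDiffOn ℝ n f B1) {k : ℕ} (hk : (k : WithTop ℕ∞) < n) {x : ℝ}
    (hx : x ∈ B1) : HasDerivWithinAt (dB k f) (dB (k + 1) f x) B1 x := by
  have := (hf.differentiableOn_iteratedDerivWithin hk uniqueDiffOn_B1 x hx).hasDerivWithinAt
  rwa [← iteratedDerivWithin_succ] at this

lemma continuousOn_dB {E : Type*} [NormedAddCommGroup E] [NormedSpace ℝ E] {f : ℝ → E}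
    {n : WithTop ℕ∞} (hf : ContDiffOn ℝ n f B1) {k : ℕ} (hk : (k : WithTop ℕ∞) ≤ n) :
    ContinuousOn (dB k f) B1 :=
  hf.continuousOn_iteratedDerivWithin hk uniqueDiffOn_B1

lemma eqOn_of_hasDerivWithinAt {f g f' : ℝ → ℝ} (hf : ∀ x ∈ B1, HasDerivWithinAt f (f' x) B1 x)
    (hg : ∀ x ∈ B1, HasDerivWithinAt g (f' x) B1 x) (h0 : f 0 = g 0) : EqOn f g B1 := by
  intro x hx
  have h := (convex_Icc (-1 : ℝ) 1).norm_image_sub_le_of_norm_hasDerivWithin_le (C := 0)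
    (f := f - g) (f' := fun _ => 0)
    (fun y hy => by
      have := (hf y hy).sub (hg y hy)
      rwa [sub_self] at this)
    (by simp) zero_mem_B1 hx
  simpa [sub_eq_zero, h0] using h

namespace IsPhase

variable {n : WithTop ℕ∞} {φ : ℝ → ℝ}

lemma isCurvature (h : IsPhase n φ) (hn : 2 ≤ n) : IsCurvature (clamp (dB 2 φ)) where
  continuous := continuous_clamp (continuousOn_dB h.contDiffOn hn)
  mem x := by
    obtain ⟨y, hy, e⟩ := exists_clamp_eq (dB 2 φ) x
    rw [e]
    exact ⟨h.lower y hy, h.upper y hy⟩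

/-- Integrating `φ''` twice, with the conditions at `0`, recovers `φ`; from here on the phase enters
only through its second derivative. -/
lemma eqOn_phaseOf (h : IsPhase n φ) (hn : 2 ≤ n) : EqOn φ (phaseOf (clamp (dB 2 φ))) B1 := by
  have hu := h.isCurvature hn
  have h1 : EqOn (dB 1 φ) (fun x => x * slopeOf (clamp (dB 2 φ)) x) B1 := by
    refine eqOn_of_hasDerivWithinAt (f' := dB 2 φ)
      (fun x hx => hasDerivWithinAt_dB h.contDiffOn (lt_of_lt_of_le (by norm_num) hn) hx)
      (fun x hx => ?_) (by simp [h.deriv_zero])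
    have := (hu.hasDerivAt_mul_slopeOf x).hasDerivWithinAt (s := B1)
    rwa [clamp_eq _ hx] at this
  refine eqOn_of_hasDerivWithinAt (f' := dB 1 φ) (fun x hx => ?_) (fun x hx => ?_)
    (by simp [h.zero, phaseOf])
  · have := hasDerivWithinAt_dB (k := 0) h.contDiffOn (lt_of_lt_of_le (by norm_num) hn) hx
    exact this.congr (fun y _ => by simp [dB]) (by simp [dB])
  · rw [h1 hx]
    exact (hu.hasDerivAt_phaseOf x).hasDerivWithinAt

end IsPhase

lemma eq_zero_of_eq_zero_outside {E : Type*} [NormedAddCommGroup E] {g : ℝ → E}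
    (hg : Continuous g) (h : ∀ x, 1 < |x| → g x = 0) {c : ℝ} (hc : |c| = 1) : g c = 0 := by
  have h1 : (1 : ℝ) ∈ closure (Ioi 1) := by rw [closure_Ioi]; exact self_mem_Ici
  have hcl : IsClosed {t : ℝ | g (t * c) = 0} := isClosed_eq (by fun_prop) continuous_const
  have := hcl.closure_subset_iff.2 (fun t (ht : 1 < t) => by
    refine h _ ?_
    rw [abs_mul, hc, mul_one]
    exact ht.trans_le (le_abs_self t)) h1
  simpa using this

namespace IsAmplitude

variable {ψ : ℝ → ℂ}

lemma iteratedDeriv_eq_zero (h : IsAmplitude ψ) (k : ℕ) {c : ℝ} (hc : |c| = 1) :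
    iteratedDeriv k ψ c = 0 := by
  refine eq_zero_of_eq_zero_outside (h.contDiff.continuous_iteratedDeriv k (by
    exact_mod_cast le_top)) (fun x hx => ?_) hc
  have : x ∉ tsupport ψ := fun hx' => absurd (abs_le.2 (h.support hx')) (not_le.2 hx)
  have h2 : iteratedFDeriv ℝ k ψ x = 0 := by
    by_contra h3
    exact this (support_iteratedFDeriv_subset k h3)
  rw [iteratedDeriv, h2]
  simp

lemma dB_eq (h : IsAmplitude ψ) (k : ℕ) {x : ℝ} (hx : x ∈ B1) : dB k ψ x = iteratedDeriv k ψ x :=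
  iteratedDerivWithin_eq_iteratedDeriv uniqueDiffOn_B1
    (h.contDiff.contDiffAt.of_le (by exact_mod_cast le_top)) hx

/-- Every derivative of a smooth function vanishing outside `B1` is continuous on the line and zero
outside, hence zero at `±1`. -/
lemma flatAt (h : IsAmplitude ψ) {c : ℝ} (hc : |c| = 1) : FlatAt ψ c := fun k =>
  (h.dB_eq k (abs_le.1 hc.le)).trans (h.iteratedDeriv_eq_zero k hc)

lemma apply_eq_zero (h : IsAmplitude ψ) {c : ℝ} (hc : |c| = 1) : ψ c = 0 :=
  (h.flatAt hc).apply_eq_zero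

lemma contDiffOn (h : IsAmplitude ψ) (n : ℕ) : ContDiffOn ℝ n ψ B1 :=
  (h.contDiff.of_le (by exact_mod_cast le_top)).contDiffOn

end IsAmplitude

lemma oscInt_eq_oscB1 {n : WithTop ℕ∞} {φ : ℝ → ℝ} {ψ : ℝ → ℂ} (hφ : IsPhase n φ) (hn : 2 ≤ n)
    (hψ : IsAmplitude ψ) (lam : ℝ) : oscInt φ ψ lam = oscB1 (clamp (dB 2 φ)) lam ψ := by
  have hs : (Function.support fun x => Complex.exp (Complex.I * ((lam * φ x : ℝ) : ℂ)) * ψ x) ⊆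
      Ioc (-1) 1 := fun x hx => by
    have hx0 : ψ x ≠ 0 := right_ne_zero_of_mul hx
    have hx1 : x ∈ B1 := hψ.support (subset_tsupport ψ hx0)
    refine ⟨lt_of_le_of_ne hx1.1 ?_, hx1.2⟩
    rintro rfl
    exact hx0 (hψ.apply_eq_zero (by simp))
  rw [oscInt, oscB1, ← intervalIntegral.integral_eq_integral_of_support_subset hs]
  refine intervalIntegral.integral_congr fun x hx => ?_
  rw [uIcc_of_le (by norm_num)] at hx
  simp only [osc, hφ.eqOn_phaseOf hn hx]

lemma remainder_eq {n : WithTop ℕ∞} {φ : ℝ → ℝ} {ψ : ℝ → ℂ} (hφ : IsPhase n φ) (hn : 2 ≤ n)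
    (hψ : IsAmplitude ψ) (lam : ℝ) : remainder φ ψ lam =
      oscB1 (clamp (dB 2 φ)) lam ψ - prefactor lam * leadCoef (clamp (dB 2 φ)) ψ := by
  rw [remainder, oscInt_eq_oscB1 hφ hn hψ, leadCoef, clamp_eq _ zero_mem_B1, Real.sqrt_eq_rpow,
    Complex.real_smul, Complex.ofReal_inv, div_eq_inv_mul]

/-- Second derivatives of a family of phases with uniformly bounded derivatives. -/
lemma uniformCk_curvature {ι : Type*} {φ : ι → ℝ → ℝ} {n : ℕ}
    (hφ : ∀ i, ContDiffOn ℝ (n + 2 : ℕ) (φ i) B1)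
    (h : ∀ k ≤ n, ∃ C, ∀ i, ∀ x ∈ B1, ‖dB (k + 2) (φ i) x‖ ≤ C) :
    UniformCk n fun i => clamp (dB 2 (φ i)) := by
  have key : ∀ {m : ℕ} {f : ℝ → ℝ}, ContDiffOn ℝ (m + 1 : ℕ) f B1 →
      ContDiffOn ℝ m (derivWithin f B1) B1 := fun {m f} hf =>
    ((contDiffOn_succ_iff_derivWithin (𝕜 := ℝ) (n := m) uniqueDiffOn_B1).1
      (by exact_mod_cast hf)).2.2
  have h2 : UniformCk n fun i => derivWithin (derivWithin (φ i) B1) B1 := by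
    refine UniformCk.of_contDiffOn (fun i => key (key (hφ i))) fun k hk => ?_
    obtain ⟨C, hC⟩ := h k hk
    refine ⟨C, fun i x hx => ?_⟩
    rw [← iteratedDerivWithin_succ', ← iteratedDerivWithin_succ']
    exact hC i x hx
  refine h2.congr fun i x hx => ?_
  rw [clamp_eq _ hx, dB, iteratedDerivWithin_succ', iteratedDerivWithin_one]

lemma norm_dB_le_S {E : Type*} [NormedAddCommGroup E] [NormedSpace ℝ E] {f : ℝ → E} {k : ℕ}
    (hf : ContinuousOn (dB k f) B1) {x : ℝ} (hx : x ∈ B1) : ‖dB k f x‖ ≤ S k f := by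
  obtain ⟨C, hC⟩ := isCompact_Icc.exists_bound_of_continuousOn hf
  refine le_ciSup (f := fun x : B1 => ‖dB k f x‖) ⟨C, ?_⟩ ⟨x, hx⟩
  rintro _ ⟨y, rfl⟩
  exact hC y y.2

lemma S_nonneg {E : Type*} [NormedAddCommGroup E] [NormedSpace ℝ E] (f : ℝ → E) (k : ℕ) :
    0 ≤ S k f := Real.iSup_nonneg fun _ => norm_nonneg _

lemma norm_dB_le_SRange {E : Type*} [NormedAddCommGroup E] [NormedSpace ℝ E] {f : ℝ → E}
    {a b k : ℕ} (hk : k ∈ Finset.Icc a b) (hf : ContinuousOn (dB k f) B1) {x : ℝ} (hx : x ∈ B1) :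
    ‖dB k f x‖ ≤ SRange a b f :=
  (norm_dB_le_S hf hx).trans
    (Finset.single_le_sum (f := fun l => S l f) (fun l _ => S_nonneg f l) hk)

end Translation

/-! ### Part (1): the third derivative of the phase measured in `L^p`. -/

section LowRegularity

open Filter Topology

lemma memLp_of_continuousOn_B1 {E : Type*} [NormedAddCommGroup E] {f : ℝ → E}
    (hf : ContinuousOn f B1) (p : ENNReal) : MemLp f p (volume.restrict B1) := by
  obtain ⟨C, hC⟩ := isCompact_Icc.exists_bound_of_continuousOn hf
  exact MemLp.of_bound (hf.aestronglyMeasurable measurableSet_Icc) C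
    ((ae_restrict_iff' measurableSet_Icc).2 (.of_forall hC))

/-- For a continuous function the essential supremum bounds every value, endpoints included, because
`B1` lies in the closure of its interior. -/
lemma norm_le_lpNormB1_top {E : Type*} [NormedAddCommGroup E] {f : ℝ → E}
    (hf : ContinuousOn f B1) {x : ℝ} (hx : x ∈ B1) : ‖f x‖ ≤ lpNormB1 ⊤ f := by
  have hfin := (memLp_of_continuousOn_B1 hf ⊤).eLpNorm_ne_top
  have hae : ∀ᵐ y ∂volume.restrict B1, ‖f y‖ ≤ lpNormB1 ⊤ f := by
    rw [eLpNorm_exponent_top] at hfin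
    filter_upwards [enorm_ae_le_eLpNormEssSup f (volume.restrict B1)] with y hy
    rw [lpNormB1, eLpNorm_exponent_top, ← toReal_enorm]
    exact ENNReal.toReal_mono hfin hy
  have heq : (fun y => max ‖f y‖ (lpNormB1 ⊤ f)) =ᵐ[volume.restrict B1]
      fun _ => lpNormB1 ⊤ f := by
    filter_upwards [hae] with y hy using max_eq_right hy
  have hcl : B1 ⊆ closure (interior B1) := by
    rw [interior_Icc, closure_Ioo (by norm_num)]
  have := Measure.eqOn_of_ae_eq heq (hf.norm.sup continuousOn_const) continuousOn_const hcl hx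
  exact max_eq_right_iff.1 this

/-- Hölder continuity at the origin of a function with derivative in `L^p`. -/
lemma abs_sub_zero_le_lpNormB1 {f f' : ℝ → ℝ} (hf' : ContinuousOn f' B1)
    (hf : ∀ x ∈ B1, HasDerivWithinAt f (f' x) B1 x) {p : ℝ} (hp : 1 ≤ p) {x : ℝ} (hx : x ∈ B1) :
    |f x - f 0| ≤ lpNormB1 (ENNReal.ofReal p) f' * |x| ^ (1 - 1 / p) := by
  obtain ⟨g, hg, hgf⟩ := exists_extension hf' hf
  have hc := continuous_clamp hf'
  have h1 := intervalIntegral.integral_eq_sub_of_hasDerivAt (fun y _ => hg y)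
    (hc.intervalIntegrable 0 x)
  rw [hgf hx, hgf zero_mem_B1] at h1
  have hsub : uIoc 0 x ⊆ B1 :=
    uIoc_subset_uIcc.trans (ordConnected_Icc.uIcc_subset zero_mem_B1 hx)
  have hmem := memLp_of_continuousOn_B1 hf' (ENNReal.ofReal p)
  have hp1 : (1 : ENNReal) ≤ ENNReal.ofReal p := by
    rw [← ENNReal.ofReal_one]
    exact ENNReal.ofReal_le_ofReal hp
  -- Hölder's inequality on the interval between `0` and `x`, whose length is `|x|`.
  have e1 : eLpNorm (clamp f') 1 (volume.restrict (uIoc 0 x)) ≤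
      eLpNorm f' (ENNReal.ofReal p) (volume.restrict B1) * ENNReal.ofReal |x| ^ (1 - 1 / p) := by
    refine (eLpNorm_le_eLpNorm_mul_rpow_measure_univ hp1 hc.aestronglyMeasurable).trans ?_
    have hv : (volume.restrict (uIoc 0 x)) univ = ENNReal.ofReal |x| := by
      rw [Measure.restrict_apply_univ, Real.volume_uIoc, sub_zero]
    rw [hv, ENNReal.toReal_ofReal (by linarith), ENNReal.toReal_one, div_one]
    refine mul_le_mul_left ((eLpNorm_mono_measure (clamp f') (Measure.restrict_mono_set _ hsub)).trans_eq
      (eLpNorm_congr_ae ?_)) _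
    exact (ae_restrict_iff' measurableSet_Icc).2 (.of_forall fun y hy => clamp_eq f' hy)
  have e2 : |f x - f 0| ≤ (eLpNorm (clamp f') 1 (volume.restrict (uIoc 0 x))).toReal := by
    rw [← h1, eLpNorm_one_eq_lintegral_enorm, ← integral_norm_eq_lintegral_enorm
      hc.aestronglyMeasurable]
    exact intervalIntegral.norm_integral_le_integral_norm_uIoc (E := ℝ) (f := clamp f')
  have hexp : 0 ≤ 1 - 1 / p := by
    rw [sub_nonneg, div_le_one (by linarith)]
    exact hp
  have e3 := ENNReal.toReal_mono (ENNReal.mul_ne_top hmem.eLpNorm_ne_top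
    (ENNReal.rpow_ne_top_of_nonneg hexp ENNReal.ofReal_ne_top)) e1
  rw [ENNReal.toReal_mul, ← ENNReal.toReal_rpow, ENNReal.toReal_ofReal (abs_nonneg _)] at e3
  exact e2.trans e3

lemma exists_cutoff_lipschitz : ∃ L : ℝ, 0 ≤ L ∧ (∀ y, |cutoff y - 1| ≤ L * |y|) ∧
    ∀ y, |deriv cutoff y| ≤ L := by
  obtain ⟨L, hL⟩ := contDiff_cutoff.lipschitzWith_of_hasCompactSupport cutoff.hasCompactSupport
    (by simp)
  refine ⟨L, L.2, fun y => ?_, fun y => norm_deriv_le_of_lipschitz hL⟩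
  have := hL.dist_le_mul y 0
  rwa [Real.dist_eq, Real.dist_eq, sub_zero, cutoff_zero] at this

lemma avg_sub_const {w u : ℝ → ℝ} (hw : Continuous w) (hu : Continuous u)
    (hw1 : ∫ t in (0 : ℝ)..1, w t = 1) (c x : ℝ) :
    avg w (fun y => u y - c) x = avg w u x - c := by
  simp only [avg, smul_eq_mul, mul_sub]
  rw [intervalIntegral.integral_sub (Continuous.intervalIntegrable (by fun_prop) _ _)
    (Continuous.intervalIntegrable (by fun_prop) _ _), intervalIntegral.integral_mul_const, hw1,
    one_mul]

namespace IsCurvature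

variable {u : ℝ → ℝ} (hu : IsCurvature u)
include hu

lemma abs_avg_sub_le {w : ℝ → ℝ} (hw : Continuous w) (hw1 : ∫ t in (0 : ℝ)..1, w t = 1) {W : ℝ}
    (hW : ∀ t ∈ Icc (0 : ℝ) 1, |w t| ≤ W) {α A : ℝ} (h0 : 0 ≤ α) (hA : 0 ≤ A)
    (h : ∀ x ∈ B1, |u x - u 0| ≤ A * |x| ^ α) {x : ℝ} (hx : x ∈ B1) :
    |avg w u x - u 0| ≤ W * (A * |x| ^ α) := by
  rw [← avg_sub_const hw hu.continuous hw1, ← Real.norm_eq_abs]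
  refine norm_avg_le hW fun t ht => (h _ (mul_mem_B1 ht hx)).trans ?_
  have : |t * x| ≤ |x| := by
    rw [abs_mul, abs_of_nonneg ht.1]
    exact mul_le_of_le_one_left (abs_nonneg x) ht.2
  gcongr

lemma inv_sqrt_le (x : ℝ) : (√(quadOf u x))⁻¹ ≤ 4 :=
  (inv_anti₀ (by norm_num) (hu.le_sqrt_quadOf x)).trans (by norm_num)

lemma abs_jac_le (x : ℝ) : |jac u x| ≤ 40 := by
  rw [jac, abs_mul, abs_of_pos (hu.slopeOf_pos x), abs_of_pos (inv_pos.2 (hu.sqrt_quadOf_pos x))]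
  have := mul_le_mul (hu.slopeOf_mem x).2 (hu.inv_sqrt_le x)
    (inv_nonneg.2 (Real.sqrt_nonneg _)) (by norm_num)
  linarith

lemma sqrt_le_four (x : ℝ) : √(quadOf u x) ≤ 4 :=
  Real.sqrt_le_iff.2 ⟨by norm_num, by linarith [(hu.quadOf_mem x).2]⟩

/-- The size of `refAmp u - refAmp u 0` and of its derivative, in terms of the modulus of
continuity of `u` at the origin. -/
lemma exists_deriv_refAmp {L : ℝ} (hL0 : 0 ≤ L) (hL : ∀ y, |cutoff y - 1| ≤ L * |y|)
    (hL' : ∀ y, |deriv cutoff y| ≤ L) {α A : ℝ} (h0 : 0 ≤ α) (h1 : α < 1)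
    (h : ∀ x ∈ B1, |u x - u 0| ≤ A * |x| ^ α) :
    ∃ g : ℝ → ℝ, ContinuousOn g (B1 \ {0}) ∧ (∀ x, x ≠ 0 → HasDerivAt (refAmp u) (g x) x) ∧
      (∀ x ∈ B1, |refAmp u x - refAmp u 0| ≤ (132 * A + 16 * L) * |x| ^ α) ∧
      ∀ x ∈ B1, x ≠ 0 → |g x| ≤ (1208 * A + 1600 * L) * |x| ^ (α - 1) := by
  have hA : 0 ≤ A := by
    have := (abs_nonneg _).trans (h 1 (by constructor <;> norm_num))
    simpa using this
  have hm : ∀ x ∈ B1, |slopeOf u x - u 0| ≤ 1 * (A * |x| ^ α) := fun x hx =>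
    hu.abs_avg_sub_le continuous_const (by simp) (by simp) h0 hA h hx
  have hq : ∀ x ∈ B1, |quadOf u x - u 0| ≤ 2 * (A * |x| ^ α) := fun x hx =>
    hu.abs_avg_sub_le (by fun_prop) integral_quad_weight (fun t ht => by
      rw [abs_of_nonneg (by linarith [ht.2])]
      linarith [ht.1]) h0 hA h hx
  set j' : ℝ → ℝ := fun x => ((u x - slopeOf u x) * (√(quadOf u x))⁻¹ -
      slopeOf u x * (slopeOf u x - quadOf u x) * (quadOf u x)⁻¹ * (√(quadOf u x))⁻¹) / x with hj'
  have cm := hu.continuous_slopeOf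
  have cq := hu.continuous_quadOf
  have cu := hu.continuous
  have cs : Continuous fun x => (√(quadOf u x))⁻¹ :=
    (Real.continuous_sqrt.comp cq).inv₀ fun x => (hu.sqrt_quadOf_pos x).ne'
  have cqi : Continuous fun x => (quadOf u x)⁻¹ := cq.inv₀ fun x => (hu.quadOf_pos x).ne'
  have cc := contDiff_cutoff.continuous
  have cc' : Continuous (deriv cutoff) := contDiff_cutoff.continuous_deriv (by simp)
  have ccoord := hu.continuous_coord
  have cjac := hu.continuous_jac
  have hchi1 : ∀ y, |cutoff y| ≤ 1 := fun y => abs_le.2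
    ⟨by linarith [cutoff.nonneg (x := y)], cutoff.le_one⟩
  refine ⟨fun x => j' x * cutoff (coord u x) + jac u x * (deriv cutoff (coord u x) * jac u x),
    ?_, fun x hx => ?_, fun x hx => ?_, fun x hx hx0 => ?_⟩
  · have : ContinuousOn j' (B1 \ {0}) := by
      refine ContinuousOn.div (Continuous.continuousOn ?_) continuousOn_id fun x hx => hx.2
      fun_prop
    refine (this.mul (Continuous.continuousOn (by fun_prop))).add
      (Continuous.continuousOn (by fun_prop))
  · have hχ : HasDerivAt cutoff (deriv cutoff (coord u x)) (coord u x) :=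
      (contDiff_cutoff.differentiable (by simp) _).hasDerivAt
    exact (hu.hasDerivAt_jac hx).mul (hχ.comp x (hu.hasDerivAt_coord x))
  · rw [hu.refAmp_zero]
    set s := √(quadOf u x) with hs
    set r := √(u 0) with hr
    have hs0 : 0 < s := hu.sqrt_quadOf_pos x
    have hsi : s⁻¹ ≤ 4 := hu.inv_sqrt_le x
    have hr0 : 0 < r := Real.sqrt_pos.2 (hu.pos 0)
    have hr4 : r ≤ 4 := Real.sqrt_le_iff.2 ⟨by norm_num, by linarith [(hu.mem 0).2]⟩
    have hs2 : s ^ 2 = quadOf u x := Real.sq_sqrt (hu.quadOf_pos x).le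
    have hr2 : r ^ 2 = u 0 := Real.sq_sqrt (hu.pos 0).le
    have hB : 0 ≤ A * |x| ^ α := by positivity
    have e : jac u x - r = (slopeOf u x - u 0) * s⁻¹ +
        r * ((u 0 - quadOf u x) * (r + s)⁻¹) * s⁻¹ := by
      have : r + s ≠ 0 := by positivity
      rw [jac, ← hs, ← hs2, ← hr2]
      field_simp
      ring
    have hrs : (r + s)⁻¹ ≤ 4 := (inv_anti₀ hs0 (by linarith)).trans hsi
    -- `132 = 4 + 128`, from the two terms of `e`: the averages `slopeOf` and `quadOf` deviate from
    -- `u 0` by at most `1` and `2` times `A |x|^α`, and `r`, `s⁻¹`, `(r + s)⁻¹` are at most `4`.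
    have hj : |jac u x - r| ≤ 132 * (A * |x| ^ α) := by
      rw [e]
      have b1 : |(slopeOf u x - u 0) * s⁻¹| ≤ (1 * (A * |x| ^ α)) * 4 := by
        rw [abs_mul, abs_of_pos (inv_pos.2 hs0)]
        exact mul_le_mul (hm x hx) hsi (by positivity) (by positivity)
      have b2 : |r * ((u 0 - quadOf u x) * (r + s)⁻¹) * s⁻¹| ≤
          4 * ((2 * (A * |x| ^ α)) * 4) * 4 := by
        rw [abs_mul, abs_mul, abs_mul, abs_of_pos (inv_pos.2 hs0), abs_of_pos hr0,
          abs_of_pos (a := (r + s)⁻¹) (by positivity), abs_sub_comm]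
        gcongr
        exact hq x hx
      refine (abs_add_le _ _).trans ((add_le_add b1 b2).trans_eq ?_)
      ring
    have hx1 : |x| ≤ |x| ^ α := by
      rcases eq_or_ne x 0 with rfl | hx0
      · rw [abs_zero]
        positivity
      · conv_lhs => rw [← Real.rpow_one |x|]
        exact Real.rpow_le_rpow_of_exponent_ge (abs_pos.2 hx0) (abs_le.2 hx) h1.le
    have hc : |cutoff (coord u x) - 1| ≤ L * (4 * |x| ^ α) := by
      refine (hL _).trans (mul_le_mul_of_nonneg_left ?_ hL0)
      rw [coord, abs_mul, abs_of_pos hs0, mul_comm]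
      exact mul_le_mul (hu.sqrt_le_four x) hx1 (abs_nonneg _) (by norm_num)
    have e2 : refAmp u x - r = (jac u x - r) * cutoff (coord u x) +
        r * (cutoff (coord u x) - 1) := by
      rw [refAmp]
      ring
    rw [e2]
    have b1 : |(jac u x - r) * cutoff (coord u x)| ≤ 132 * (A * |x| ^ α) * 1 := by
      rw [abs_mul]
      exact mul_le_mul hj (hchi1 _) (abs_nonneg _) (by positivity)
    have b2 : |r * (cutoff (coord u x) - 1)| ≤ 4 * (L * (4 * |x| ^ α)) := by
      rw [abs_mul, abs_of_pos hr0]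
      exact mul_le_mul hr4 hc (abs_nonneg _) (by norm_num)
    refine (abs_add_le _ _).trans ((add_le_add b1 b2).trans_eq ?_)
    ring
  · have hxp : 0 < |x| := abs_pos.2 hx0
    have hB : 0 ≤ A * |x| ^ α := by positivity
    have hs0 := hu.sqrt_quadOf_pos x
    have hsi := hu.inv_sqrt_le x
    have hqi : (quadOf u x)⁻¹ ≤ 10 :=
      (inv_anti₀ (by norm_num) (hu.quadOf_mem x).1).trans (by norm_num)
    have hq0 := hu.quadOf_pos x
    have d1 : |u x - slopeOf u x| ≤ 2 * (A * |x| ^ α) := by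
      have := abs_sub_le (u x) (u 0) (slopeOf u x)
      rw [abs_sub_comm (u 0)] at this
      linarith [h x hx, hm x hx]
    have d2 : |slopeOf u x - quadOf u x| ≤ 3 * (A * |x| ^ α) := by
      have := abs_sub_le (slopeOf u x) (u 0) (quadOf u x)
      rw [abs_sub_comm (u 0)] at this
      linarith [hq x hx, hm x hx]
    -- `1208 = 2 * 4 + 10 * 3 * 10 * 4`. The differences `u - slopeOf u` and `slopeOf u - quadOf u`
    -- are `O(|x|^α)`, which weakens the singularity `1 / x` to `|x|^(α-1)`.
    have hj : |j' x| ≤ 1208 * A * |x| ^ (α - 1) := by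
      have b1 : |(u x - slopeOf u x) * (√(quadOf u x))⁻¹| ≤ (2 * (A * |x| ^ α)) * 4 := by
        rw [abs_mul, abs_of_pos (inv_pos.2 hs0)]
        exact mul_le_mul d1 hsi (by positivity) (by positivity)
      have b2 : |slopeOf u x * (slopeOf u x - quadOf u x) * (quadOf u x)⁻¹ * (√(quadOf u x))⁻¹| ≤
          10 * (3 * (A * |x| ^ α)) * 10 * 4 := by
        rw [abs_mul, abs_mul, abs_mul, abs_of_pos (inv_pos.2 hs0), abs_of_pos (inv_pos.2 hq0),
          abs_of_pos (hu.slopeOf_pos x)]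
        gcongr
        exact (hu.slopeOf_mem x).2
      rw [hj', abs_div, Real.rpow_sub_one hxp.ne', ← mul_div_assoc]
      refine div_le_div_of_nonneg_right ((abs_sub _ _).trans ((add_le_add b1 b2).trans_eq ?_))
        hxp.le
      ring
    have hone : 1 ≤ |x| ^ (α - 1) :=
      Real.one_le_rpow_of_pos_of_le_one_of_nonpos hxp (abs_le.2 hx) (by linarith)
    have b1 : |j' x * cutoff (coord u x)| ≤ 1208 * A * |x| ^ (α - 1) * 1 := by
      rw [abs_mul]
      exact mul_le_mul hj (hchi1 _) (abs_nonneg _) (by positivity)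
    have b2 : |jac u x * (deriv cutoff (coord u x) * jac u x)| ≤ 40 * (L * 40) := by
      rw [abs_mul, abs_mul]
      have := hu.abs_jac_le x
      have := hL' (coord u x)
      gcongr
    have b3 : 40 * (L * 40) ≤ 1600 * L * |x| ^ (α - 1) := by
      have : 0 ≤ L * 40 := by positivity
      nlinarith
    refine (abs_add_le _ _).trans ?_
    linarith

end IsCurvature

/-- The remainder bound in terms of the `L^p` norm of the third derivative of the phase. -/
theorem exists_remainder_le_lpNorm {p : ℝ} (hp : 1 ≤ p) : ∃ C : ℝ, ∀ (φ : ℝ → ℝ) (ψ : ℝ → ℂ)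
    (lam : ℝ), IsPhase 3 φ → IsAmplitude ψ → 0 < lam →
      ‖remainder φ ψ lam‖ ≤ C * lam ^ (-1 + 1 / (2 * p)) *
        (lpNormB1 (ENNReal.ofReal p) (dB 3 φ) * lpNormB1 ⊤ ψ + lpNormB1 ⊤ (dB 1 ψ)) := by
  have hp0 : 0 < p := by linarith
  obtain ⟨α, hα⟩ : ∃ α, α = 1 - 1 / p := ⟨_, rfl⟩
  have h0 : 0 ≤ α := by
    rw [hα, sub_nonneg, div_le_one hp0]
    exact hp
  have h1 : α < 1 := by
    rw [hα]
    have : 0 < 1 / p := by positivity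
    linarith
  have hexp : -1 + 1 / (2 * p) = -((1 + α) / 2) := by
    rw [hα]
    field_simp
    ring
  obtain ⟨L, hL0, hL, hL'⟩ := exists_cutoff_lipschitz
  obtain ⟨F, hF0, hF⟩ := exists_fresnel_sub_prefactor_rpow_bound (s := (1 + α) / 2) (by linarith)
  have hα1 : 0 < 1 - α := by linarith
  -- The constants of `exists_deriv_refAmp` for the derivative, times the factor `4` of
  -- `norm_leadCoef_le`, plus `1` for `ψ'`; the constants for the values are smaller.
  set G : ℝ := 4 * 1208 + 4 * 1600 * L + 1 with hG
  refine ⟨4 * F + 2 * (21 + 1010 / (1 - α)) * G, fun φ ψ lam hφ hψ hlam => ?_⟩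
  have hu := hφ.isCurvature (by norm_num)
  set u := clamp (dB 2 φ) with hudef
  set A := lpNormB1 (ENNReal.ofReal p) (dB 3 φ) with hAdef
  set U := lpNormB1 ⊤ ψ
  set V := lpNormB1 ⊤ (dB 1 ψ)
  have hA0 : 0 ≤ A := ENNReal.toReal_nonneg
  have hU0 : 0 ≤ U := ENNReal.toReal_nonneg
  have hV0 : 0 ≤ V := ENNReal.toReal_nonneg
  have hhol : ∀ x ∈ B1, |u x - u 0| ≤ A * |x| ^ α := fun x hx => by
    rw [hudef, clamp_eq _ hx, clamp_eq _ zero_mem_B1, hα]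
    exact abs_sub_zero_le_lpNormB1 (continuousOn_dB hφ.contDiffOn (by norm_num))
      (fun x hx => hasDerivWithinAt_dB (k := 2) hφ.contDiffOn (by norm_num) hx) hp hx
  obtain ⟨g, hgc, hgd, hg0, hg1⟩ := hu.exists_deriv_refAmp hL0 hL hL' h0 h1 hhol
  have hψ1 : ∀ x ∈ B1, HasDerivWithinAt ψ (dB 1 ψ x) B1 x := fun x hx => by
    have := hasDerivWithinAt_dB (k := 0) (hψ.contDiffOn 1) (by norm_num) hx
    exact this.congr (fun y _ => by simp [dB]) (by simp [dB])
  have hψ1c : ContinuousOn (dB 1 ψ) B1 := continuousOn_dB (hψ.contDiffOn 1) (by norm_num)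
  have hψc : ContinuousOn ψ B1 := hψ.contDiff.continuous.continuousOn
  have hψV : ∀ x ∈ B1, ‖dB 1 ψ x‖ ≤ V := fun x hx => norm_le_lpNormB1_top hψ1c hx
  have hψlip : ∀ x ∈ B1, ‖ψ x - ψ 0‖ ≤ V * |x| := fun x hx => by
    have := (convex_Icc (-1 : ℝ) 1).norm_image_sub_le_of_norm_hasDerivWithin_le hψ1 hψV
      zero_mem_B1 hx
    simpa using this
  have hψ0U : ‖ψ 0‖ ≤ U := norm_le_lpNormB1_top hψc zero_mem_B1
  -- As `ψ 1 = 0`, the value `ψ 0` is also controlled by `ψ'`. This handles the errors coming from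
  -- the cutoff and the Fresnel tail, which carry no factor `A` and so cannot be absorbed by `A *
  -- U`.
  have hψ0V : ‖ψ 0‖ ≤ V := by
    have := hψlip 1 (by constructor <;> norm_num)
    rw [hψ.apply_eq_zero (by simp)] at this
    simpa using this
  have hc := norm_leadCoef_le hu ψ
  set c := leadCoef u ψ with hcdef
  have hc0 : 0 ≤ ‖c‖ := norm_nonneg c
  have hcA : ‖c‖ * A ≤ 4 * (A * U) := by nlinarith
  have hcL : ‖c‖ * L ≤ 4 * (L * V) := by nlinarith
  have hAU : 0 ≤ A * U := by positivity
  have hLV : 0 ≤ L * V := by positivity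
  have hLAU : 0 ≤ L * (A * U) := by positivity
  have e : ψ 0 = refAmp u 0 • c := by
    have := residual_zero hu ψ
    rwa [residual, sub_eq_zero] at this
  have hmain := hu.norm_integral_osc_phaseOf_le h0 h1 (f := residual u ψ)
    (f' := fun x => dB 1 ψ x - g x • c) (A := G * (A * U + V)) (lam := lam)
    (hψc.sub (hu.continuous_refAmp.smul continuous_const).continuousOn)
    (fun x hx hx0 => ((hψ1 x ⟨hx.1.le, hx.2.le⟩).hasDerivAt (Icc_mem_nhds hx.1 hx.2)).sub
      ((hgd x hx0).smul_const c))
    ((hψ1c.mono sdiff_subset).sub (hgc.smul continuousOn_const))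
    (fun x hx hx0 => by
      have hxp : 0 < |x| := abs_pos.2 hx0
      have hx1 : |x| ≤ |x| ^ α := by
        conv_lhs => rw [← Real.rpow_one |x|]
        exact Real.rpow_le_rpow_of_exponent_ge hxp (abs_le.2 hx) h1.le
      have e1 : residual u ψ x = (ψ x - ψ 0) - (refAmp u x - refAmp u 0) • c := by
        rw [residual, sub_smul, ← e]
        ring
      have b1 : ‖(refAmp u x - refAmp u 0) • c‖ ≤ (132 * A + 16 * L) * |x| ^ α * ‖c‖ := by
        rw [norm_smul]
        exact mul_le_mul_of_nonneg_right (hg0 x hx) (norm_nonneg _)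
      have b2 : (132 * A + 16 * L) * ‖c‖ ≤ 132 * (4 * (A * U)) + 16 * (4 * (L * V)) := by
        nlinarith
      have b3 : V + (132 * (4 * (A * U)) + 16 * (4 * (L * V))) ≤ G * (A * U + V) := by
        rw [hG]
        nlinarith
      have hpos : 0 ≤ |x| ^ α := by positivity
      rw [e1]
      calc _ ≤ V * |x| ^ α + (132 * A + 16 * L) * |x| ^ α * ‖c‖ :=
            (norm_sub_le _ _).trans (add_le_add ((hψlip x hx).trans
              (mul_le_mul_of_nonneg_left hx1 hV0)) b1)
        _ = (V + (132 * A + 16 * L) * ‖c‖) * |x| ^ α := by ring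
        _ ≤ _ := mul_le_mul_of_nonneg_right (by linarith) hpos)
    (fun x hx hx0 => by
      have hxp : 0 < |x| := abs_pos.2 hx0
      have hone : 1 ≤ |x| ^ (α - 1) :=
        Real.one_le_rpow_of_pos_of_le_one_of_nonpos hxp (abs_le.2 hx) (by linarith)
      have b1 : ‖g x • c‖ ≤ (1208 * A + 1600 * L) * |x| ^ (α - 1) * ‖c‖ := by
        rw [norm_smul]
        exact mul_le_mul_of_nonneg_right (hg1 x hx hx0) (norm_nonneg _)
      have b2 : (1208 * A + 1600 * L) * ‖c‖ ≤ 1208 * (4 * (A * U)) + 1600 * (4 * (L * V)) := by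
        nlinarith
      have b3 : V + (1208 * (4 * (A * U)) + 1600 * (4 * (L * V))) ≤ G * (A * U + V) := by
        rw [hG]
        nlinarith
      have hpos : 0 ≤ |x| ^ (α - 1) := by positivity
      calc _ ≤ V * |x| ^ (α - 1) + (1208 * A + 1600 * L) * |x| ^ (α - 1) * ‖c‖ :=
            (norm_sub_le _ _).trans (add_le_add ((hψV x hx).trans
              (le_mul_of_one_le_right hV0 hone)) b1)
        _ = (V + (1208 * A + 1600 * L) * ‖c‖) * |x| ^ (α - 1) := by ring
        _ ≤ _ := mul_le_mul_of_nonneg_right (by linarith) hpos) hlam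
  rw [remainder_eq hφ (by norm_num) hψ, oscB1_eq_add_residual hu lam hψc, hexp]
  have hsplit : c * fresnel lam + oscB1 u lam (residual u ψ) - prefactor lam * c =
      c * (fresnel lam - prefactor lam) + oscB1 u lam (residual u ψ) := by ring
  rw [hsplit]
  have hl : 0 < lam ^ (-((1 + α) / 2)) := by positivity
  have b1 : ‖c * (fresnel lam - prefactor lam)‖ ≤
      4 * (A * U + V) * (F * lam ^ (-((1 + α) / 2))) := by
    rw [norm_mul]
    exact mul_le_mul (by linarith) (hF lam hlam) (norm_nonneg _) (by positivity)
  refine (norm_add_le _ _).trans ((add_le_add b1 hmain).trans_eq ?_)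
  ring

end LowRegularity

/-! ### Parts (2) and (3): integration by parts, once and repeatedly. -/

section Expansion

open Filter Topology

variable {ι : Type*} {u : ι → ℝ → ℝ} {f : ι → ℝ → ℂ}

/-- The oscillatory integral of a uniformly `C^1` family of amplitudes is `O(λ^{-1/2})`. -/
lemma exists_oscB1_bound (hu : ∀ i, IsCurvature (u i)) (hf : UniformCk 1 f) :
    ∃ C, 0 ≤ C ∧ ∀ i lam, 0 < lam → ‖oscB1 (u i) lam (f i)‖ ≤ C * lam ^ (-(1 / 2) : ℝ) := by
  obtain ⟨A, hA0, hA⟩ := hf.exists_bound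
  obtain ⟨B, hB0, hB⟩ := hf.derivFamily.exists_bound
  refine ⟨2 * (21 + 1010 / (1 - 0)) * (A + B), by positivity, fun i lam hlam => ?_⟩
  have := (hu i).norm_integral_osc_phaseOf_le le_rfl one_pos (f := f i)
    (f' := derivWithin (f i) B1) (A := A + B) (hf.continuousOn i)
    (fun x hx _ => (hf.hasDerivWithinAt i ⟨hx.1.le, hx.2.le⟩).hasDerivAt
      (Icc_mem_nhds hx.1 hx.2))
    ((hf.derivFamily.continuousOn i).mono sdiff_subset)
    (fun x hx hx0 => by
      rw [Real.rpow_zero, mul_one]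
      linarith [hA i x hx])
    (fun x hx hx0 => by
      have h1 : 1 ≤ |x| ^ ((0 : ℝ) - 1) :=
        Real.one_le_rpow_of_pos_of_le_one_of_nonpos (abs_pos.2 hx0) (abs_le.2 hx) (by norm_num)
      have := hB i x hx
      calc _ ≤ (A + B) * 1 := by linarith
        _ ≤ _ := mul_le_mul_of_nonneg_left h1 (by positivity)) hlam
  rw [add_zero] at this
  exact this

/-- The oscillatory integral of the reduced amplitude is `O(λ^{-1/2})` already for a uniformly `C^2`
family. -/
lemma exists_oscB1_reduce_bound (hu : ∀ i, IsCurvature (u i)) (h : UniformCk 2 u)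
    (hf : UniformCk 2 f) :
    ∃ C, 0 ≤ C ∧ ∀ i lam, 0 < lam →
      ‖oscB1 (u i) lam (reduce (u i) (f i))‖ ≤ C * lam ^ (-(1 / 2) : ℝ) := by
  have hq : UniformCk 1 fun i => quotient (u i) (f i) := uniformCk_quotient hu h hf
  have hr : UniformCk 2 fun i => residual (u i) (f i) := uniformCk_residual hu h hf
  have hr1 := hr.derivFamily
  have hmul := fun i x hx => mul_slopeOf_smul_quotient hu h.pred hf.pred i (x := x) hx
  obtain ⟨A, hA0, hA⟩ := hq.exists_bound
  obtain ⟨B, hB0, hB⟩ := hq.derivFamily.exists_bound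
  obtain ⟨D, hD0, hD⟩ := hr1.derivFamily.exists_bound
  obtain ⟨E, hE0, hE⟩ := h.derivFamily.exists_bound
  -- the derivative of the reduced amplitude away from the origin
  have hslope : ∀ i (x : ℝ), x ≠ 0 → ((x * slopeOf (u i) x : ℝ)) ≠ 0 := fun i x hx =>
    mul_ne_zero hx ((hu i).slopeOf_pos x).ne'
  have hred : ∀ i, ∀ x ∈ B1, x ≠ 0 → reduce (u i) (f i) x = (x * slopeOf (u i) x)⁻¹ •
      (derivWithin (residual (u i) (f i)) B1 x - u i x • quotient (u i) (f i) x) := by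
    intro i x hx hx0
    have h1 := ((hu i).hasDerivAt_mul_slopeOf x).hasDerivWithinAt (s := B1) |>.smul
      (hq.hasDerivWithinAt i hx)
    have h2 := (h1.congr (fun y hy => (hmul i y hy).symm) (hmul i x hx).symm).derivWithin
      (uniqueDiffOn_B1 x hx)
    rw [h2, add_sub_cancel_right, inv_smul_smul₀ (hslope i x hx0)]
    rfl
  -- Let `r` be the residual and `Q` the quotient. Differentiating `φ' Q = r` twice gives `φ' Q'' =
  -- r'' - u' Q - 2 u Q'`. So `Q''` is `O(1 / |x|)` off the origin without assuming third
  -- derivatives of `f` or `u`; that is the hypothesis of the splitting bound with `α = 0`.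
  set d : ι → ℝ → ℂ := fun i x => (x * slopeOf (u i) x)⁻¹ •
    (derivWithin (derivWithin (residual (u i) (f i)) B1) B1 x -
      derivWithin (u i) B1 x • quotient (u i) (f i) x - (2 * u i x) • reduce (u i) (f i) x) with hd
  have hdd : ∀ i, ∀ x ∈ Ioo (-1 : ℝ) 1, x ≠ 0 → HasDerivAt (reduce (u i) (f i)) (d i x) x := by
    intro i x hx hx0
    have hxB : x ∈ B1 := ⟨hx.1.le, hx.2.le⟩
    have hnhds : B1 ∈ 𝓝 x := Icc_mem_nhds hx.1 hx.2
    have he : reduce (u i) (f i) =ᶠ[𝓝 x] fun x => (x * slopeOf (u i) x)⁻¹ •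
        (derivWithin (residual (u i) (f i)) B1 x - u i x • quotient (u i) (f i) x) := by
      filter_upwards [hnhds, isOpen_ne.mem_nhds hx0] with y hy hy0 using hred i y hy hy0
    have k1 := (hr1.hasDerivWithinAt i hxB).hasDerivAt hnhds
    have k2 := ((h.pred.hasDerivWithinAt i hxB).hasDerivAt hnhds).smul
      ((hq.hasDerivWithinAt i hxB).hasDerivAt hnhds)
    have k3 := ((hu i).hasDerivAt_mul_slopeOf x).inv (hslope i x hx0)
    refine ((k3.smul (k1.sub k2)).congr_of_eventuallyEq he).congr_deriv ?_
    have e1 : derivWithin (quotient (u i) (f i)) B1 x = reduce (u i) (f i) x := rfl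
    have hs := hslope i x hx0
    simp only [hd, e1, Pi.sub_apply, Pi.smul_apply', Pi.inv_apply, hred i x hxB hx0,
      Complex.real_smul]
    have hs' : (x : ℂ) * (slopeOf (u i) x : ℂ) ≠ 0 := by exact_mod_cast hs
    have hx' : (x : ℂ) ≠ 0 := left_ne_zero_of_mul hs'
    have hs'' : (slopeOf (u i) x : ℂ) ≠ 0 := right_ne_zero_of_mul hs'
    push_cast
    field_simp
    ring
  refine ⟨2 * (21 + 1010 / (1 - 0)) * (B + 10 * (D + E * A + 20 * B)), by positivity,
    fun i lam hlam => ?_⟩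
  have hucont : ContinuousOn (u i) B1 := (hu i).continuous.continuousOn
  have hscont := (hu i).continuous_slopeOf
  have hqc : ContinuousOn (quotient (u i) (f i)) B1 := hq.continuousOn i
  have hredc : ContinuousOn (reduce (u i) (f i)) B1 := hq.derivFamily.continuousOn i
  have hBr : ∀ x ∈ B1, ‖reduce (u i) (f i) x‖ ≤ B := fun x hx => hB i x hx
  have := (hu i).norm_integral_osc_phaseOf_le le_rfl one_pos (f := reduce (u i) (f i))
    (f' := d i) (A := B + 10 * (D + E * A + 20 * B)) hredc (hdd i)
    (by
      refine ContinuousOn.smul (ContinuousOn.inv₀ (by fun_prop) fun x hx => hslope i x hx.2) ?_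
      exact (((hr1.derivFamily.continuousOn i).sub
        ((h.derivFamily.continuousOn i).smul hqc)).sub
        ((hucont.const_smul (2 : ℝ)).smul hredc)).mono sdiff_subset)
    (fun x hx hx0 => by
      rw [Real.rpow_zero, mul_one]
      have : 0 ≤ 10 * (D + E * A + 20 * B) := by positivity
      linarith [hBr x hx])
    (fun x hx hx0 => by
      have hxp : 0 < |x| := abs_pos.2 hx0
      have c1 : ‖(x * slopeOf (u i) x)⁻¹‖ ≤ 10 * |x|⁻¹ := by
        rw [norm_inv, norm_mul, mul_inv, Real.norm_eq_abs, Real.norm_eq_abs,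
          abs_of_pos ((hu i).slopeOf_pos x), mul_comm]
        refine mul_le_mul_of_nonneg_right ?_ (by positivity)
        exact (inv_anti₀ (by norm_num) ((hu i).slopeOf_mem x).1).trans (by norm_num)
      have c2 : ‖derivWithin (u i) B1 x • quotient (u i) (f i) x‖ ≤ E * A := by
        rw [norm_smul]
        exact mul_le_mul (hE i x hx) (hA i x hx) (norm_nonneg _) hE0
      have c3 : ‖(2 * u i x) • reduce (u i) (f i) x‖ ≤ 20 * B := by
        rw [norm_smul, Real.norm_of_nonneg (by linarith [(hu i).pos x])]
        exact mul_le_mul (by linarith [((hu i).mem x).2]) (hBr x hx) (norm_nonneg _) (by norm_num)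
      have c4 := (norm_sub_le (derivWithin (derivWithin (residual (u i) (f i)) B1) B1 x -
        derivWithin (u i) B1 x • quotient (u i) (f i) x) ((2 * u i x) • reduce (u i) (f i) x)).trans
        (add_le_add ((norm_sub_le _ _).trans (add_le_add (hD i x hx) c2)) c3)
      have hxi : 0 ≤ |x|⁻¹ := by positivity
      rw [zero_sub, Real.rpow_neg_one, hd, norm_smul]
      calc _ ≤ 10 * |x|⁻¹ * (D + E * A + 20 * B) :=
            mul_le_mul c1 c4 (norm_nonneg _) (by positivity)
        _ = 10 * (D + E * A + 20 * B) * |x|⁻¹ := by ring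
        _ ≤ _ := mul_le_mul_of_nonneg_right (by linarith) hxi) hlam
  rw [add_zero] at this
  exact this

lemma norm_I_mul_inv_pow {lam : ℝ} (hlam : 0 < lam) (k : ℕ) :
    ‖(Complex.I * (lam : ℂ)⁻¹) ^ k‖ = lam ^ (-(k : ℝ)) := by
  rw [norm_pow, norm_mul, Complex.norm_I, one_mul, norm_inv, Complex.norm_real,
    Real.norm_of_nonneg hlam.le, Real.rpow_neg hlam.le, Real.rpow_natCast, inv_pow]

/-- The remainder bound for families of phases and amplitudes of finite smoothness. -/
lemma exists_remainder_bound {φ : ι → ℝ → ℝ} (hφ : ∀ i, IsPhase 4 (φ i))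
    (hψ : ∀ i, IsAmplitude (f i)) (hu : UniformCk 2 fun i => clamp (dB 2 (φ i)))
    (hf : UniformCk 2 f) :
    ∃ C, 0 ≤ C ∧ ∀ i lam, 0 < lam → ‖remainder (φ i) (f i) lam‖ ≤ C * lam ^ (-(3 / 2) : ℝ) := by
  have hcurv : ∀ i, IsCurvature (clamp (dB 2 (φ i))) := fun i =>
    (hφ i).isCurvature (by norm_num)
  obtain ⟨A, hA0, hA⟩ := hf.exists_bound
  obtain ⟨F, hF0, hF⟩ := exists_fresnel_sub_prefactor_rpow_bound (s := 3 / 2) (by norm_num)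
  obtain ⟨B, hB0, hB⟩ := exists_oscB1_reduce_bound hcurv hu hf
  refine ⟨4 * A * F + B, by positivity, fun i lam hlam => ?_⟩
  rw [remainder_eq (hφ i) (by norm_num) (hψ i),
    oscB1_eq_add_residual (hcurv i) lam (hf.continuousOn i),
    oscB1_residual hcurv hu hf i ((hψ i).apply_eq_zero (by simp)) ((hψ i).apply_eq_zero (by simp))
      hlam]
  set c := leadCoef (clamp (dB 2 (φ i))) (f i) with hc
  have hcA : ‖c‖ ≤ 4 * A := (norm_leadCoef_le (hcurv i) (f i)).trans
    (mul_le_mul_of_nonneg_left (hA i 0 zero_mem_B1) (by norm_num))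
  have b1 : ‖c * (fresnel lam - prefactor lam)‖ ≤ 4 * A * (F * lam ^ (-(3 / 2) : ℝ)) := by
    rw [norm_mul]
    exact mul_le_mul hcA (hF lam hlam) (norm_nonneg _) (by positivity)
  have b2 : ‖Complex.I * (lam : ℂ)⁻¹ * oscB1 (clamp (dB 2 (φ i))) lam
      (reduce (clamp (dB 2 (φ i))) (f i))‖ ≤ B * lam ^ (-(3 / 2) : ℝ) := by
    have h1 := norm_I_mul_inv_pow hlam 1
    rw [pow_one, Nat.cast_one] at h1
    rw [norm_mul, h1]
    have h2 : lam ^ (-(3 / 2) : ℝ) = lam ^ (-1 : ℝ) * lam ^ (-(1 / 2) : ℝ) := by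
      rw [← Real.rpow_add hlam]
      norm_num
    rw [h2]
    calc _ ≤ lam ^ (-1 : ℝ) * (B * lam ^ (-(1 / 2) : ℝ)) :=
          mul_le_mul_of_nonneg_left (hB i lam hlam) (by positivity)
      _ = _ := by ring
  have e : ∀ R : ℂ, c * fresnel lam + R - prefactor lam * c =
      c * (fresnel lam - prefactor lam) + R := fun R => by ring
  rw [e]
  refine (norm_add_le _ _).trans ((add_le_add b1 b2).trans_eq ?_)
  ring

/-- The remainder bound with a universal function of the norms of the phase and the amplitude. -/
theorem exists_remainder_le_SRange : ∃ C : ℝ → ℝ → ℝ,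
    (∀ a a' b b' : ℝ, a ≤ a' → b ≤ b' → C a b ≤ C a' b') ∧
      ∀ (φ : ℝ → ℝ) (ψ : ℝ → ℂ) (lam : ℝ), IsPhase 4 φ → IsAmplitude ψ → 0 < lam →
      ‖remainder φ ψ lam‖ ≤ lam ^ (-(3 / 2) : ℝ) * C (SRange 2 4 φ) (SRange 0 2 ψ) := by
  have key : ∀ N : ℕ, ∃ C, 0 ≤ C ∧ ∀ (φ : ℝ → ℝ) (ψ : ℝ → ℂ) (lam : ℝ), IsPhase 4 φ →
      IsAmplitude ψ → SRange 2 4 φ ≤ N → SRange 0 2 ψ ≤ N → 0 < lam →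
      ‖remainder φ ψ lam‖ ≤ C * lam ^ (-(3 / 2) : ℝ) := by
    intro N
    -- All pairs with norms at most `N` form one family, so the family bound is a constant depending
    -- on `N` only.
    let ι := {q : (ℝ → ℝ) × (ℝ → ℂ) // IsPhase 4 q.1 ∧ IsAmplitude q.2 ∧ SRange 2 4 q.1 ≤ N ∧
      SRange 0 2 q.2 ≤ N}
    obtain ⟨C, hC0, hC⟩ := exists_remainder_bound (ι := ι) (φ := fun i => i.1.1)
      (f := fun i => i.1.2) (fun i => i.2.1) (fun i => i.2.2.1)
      (uniformCk_curvature (n := 2) (fun i => i.2.1.contDiffOn) fun k hk =>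
        ⟨N, fun i x hx => (norm_dB_le_SRange (a := 2) (b := 4)
          (Finset.mem_Icc.2 ⟨by omega, by omega⟩)
          (continuousOn_dB i.2.1.contDiffOn (by exact_mod_cast (by omega : k + 2 ≤ 4)))
          hx).trans i.2.2.2.1⟩)
      (UniformCk.of_contDiffOn (fun i => i.2.2.1.contDiffOn 2) fun k hk =>
        ⟨N, fun i x hx => (norm_dB_le_SRange (a := 0) (b := 2)
          (Finset.mem_Icc.2 ⟨by omega, by omega⟩)
          (continuousOn_dB (i.2.2.1.contDiffOn 2) (by exact_mod_cast hk)) hx).trans i.2.2.2.2⟩)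
    exact ⟨C, hC0, fun φ ψ lam h1 h2 h3 h4 hlam => hC ⟨(φ, ψ), h1, h2, h3, h4⟩ lam hlam⟩
  choose C hC0 hC using key
  -- Partial sums of the nonnegative constants `C N` are monotone in the upper limit and dominate
  -- the single term needed, although `C` itself need not be monotone.
  refine ⟨fun a b => ∑ N ∈ Finset.range (⌈max a b⌉₊ + 1), C N, fun a a' b b' ha hb => ?_,
    fun φ ψ lam hφ hψ hlam => ?_⟩
  · refine Finset.sum_le_sum_of_subset_of_nonneg (Finset.range_mono ?_) fun N _ _ => hC0 N
    exact Nat.add_le_add_right (Nat.ceil_mono (max_le_max ha hb)) 1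
  · set N := ⌈max (SRange 2 4 φ) (SRange 0 2 ψ)⌉₊ with hN
    have hle := Nat.le_ceil (max (SRange 2 4 φ) (SRange 0 2 ψ))
    rw [mul_comm]
    refine (hC N φ ψ lam hφ hψ ((le_max_left _ _).trans hle) ((le_max_right _ _).trans hle)
      hlam).trans (mul_le_mul_of_nonneg_right ?_ (by positivity))
    exact Finset.single_le_sum (f := C) (fun N _ => hC0 N) (Finset.self_mem_range_succ N)

/-- The coefficients of the stationary phase expansion. -/
def expansionCoef (u : ℝ → ℝ) (f : ℝ → ℂ) (k : ℕ) : ℂ :=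
  (k.factorial : ℂ) * Complex.I ^ k * leadCoef u ((reduce u)^[k] f)

/-- The factorial in `expansionCoef` cancels the `k!` of the stated expansion, and the leading term
is the summand `k = 0`. -/
lemma sum_expansionCoef (u : ℝ → ℝ) (f : ℝ → ℂ) {lam : ℝ} (hlam : 0 < lam) (K : ℕ) :
    leadCoef u f + ∑ k ∈ Finset.Icc 1 K,
      expansionCoef u f k * ((lam ^ (-(k : ℝ)) : ℝ) : ℂ) / (k.factorial : ℂ) =
    ∑ k ∈ Finset.range (K + 1),
      (Complex.I * (lam : ℂ)⁻¹) ^ k * leadCoef u ((reduce u)^[k] f) := by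
  induction K with
  | zero => simp
  | succ K ih =>
    rw [Finset.sum_Icc_succ_top (by omega), ← add_assoc, ih, Finset.sum_range_succ _ (K + 1)]
    congr 1
    have : ((K + 1).factorial : ℂ) ≠ 0 := by exact_mod_cast (K + 1).factorial_ne_zero
    rw [Real.rpow_neg hlam.le, Real.rpow_natCast, expansionCoef, mul_pow, inv_pow]
    push_cast
    field_simp

/-- The full expansion for families of smooth phases and amplitudes. -/
lemma exists_expansion_bound {φ : ι → ℝ → ℝ} (hφ : ∀ i, IsPhase ∞ (φ i))
    (hψ : ∀ i, IsAmplitude (f i)) (hu : ∀ n, UniformCk n fun i => clamp (dB 2 (φ i)))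
    (hf : ∀ n, UniformCk n f) (K : ℕ) :
    ∃ A D : ℝ, ∀ i, (∀ k ∈ Finset.Icc 1 K,
        ‖expansionCoef (clamp (dB 2 (φ i))) (f i) k‖ ≤ A ^ k) ∧
      ∀ lam, 0 < lam → ‖remainder (φ i) (f i) lam - prefactor lam *
        ∑ k ∈ Finset.Icc 1 K, expansionCoef (clamp (dB 2 (φ i))) (f i) k *
          ((lam ^ (-(k : ℝ)) : ℝ) : ℂ) / (k.factorial : ℂ)‖ ≤ D * lam ^ (-(K : ℝ) - 3 / 2) := by
  have h2 : (2 : WithTop ℕ∞) ≤ ∞ :=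
    (fun n => by exact_mod_cast le_top : ∀ n : ℕ, (n : WithTop ℕ∞) ≤ ∞) 2
  have hcurv : ∀ i, IsCurvature (clamp (dB 2 (φ i))) := fun i => (hφ i).isCurvature h2
  have hiter := uniformCk_iterate_reduce hcurv hu hf
  have hB : ∀ k, ∃ B, 0 ≤ B ∧ ∀ i, ‖leadCoef (clamp (dB 2 (φ i)))
      ((reduce (clamp (dB 2 (φ i))))^[k] (f i))‖ ≤ B := fun k => by
    obtain ⟨B, hB0, hB⟩ := (hiter k 0).exists_bound
    exact ⟨4 * B, by positivity, fun i => (norm_leadCoef_le (hcurv i) _).trans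
      (mul_le_mul_of_nonneg_left (hB i 0 zero_mem_B1) (by norm_num))⟩
  choose B hB0 hB using hB
  -- The `k`-th term already carries `λ⁻ᵏ`, so the Fresnel error is needed to order `K + 3/2 - k`.
  -- Indices beyond `K` get a dummy value.
  have hF : ∀ k, ∃ F, 0 ≤ F ∧ (k ≤ K → ∀ lam : ℝ, 0 < lam →
      ‖fresnel lam - prefactor lam‖ ≤ F * lam ^ (-((K : ℝ) + 3 / 2 - k))) := fun k => by
    by_cases hk : k ≤ K
    · have hk' : (k : ℝ) ≤ K := by exact_mod_cast hk
      obtain ⟨F, hF0, hF⟩ := exists_fresnel_sub_prefactor_rpow_bound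
        (s := (K : ℝ) + 3 / 2 - k) (by linarith)
      exact ⟨F, hF0, fun _ => hF⟩
    · exact ⟨0, le_rfl, fun h => absurd h hk⟩
  choose F hF0 hF using hF
  -- After `K + 1` reductions the factor `λ^(-K-1)` and this `λ^(-1/2)` together give the order `K +
  -- 3/2`.
  obtain ⟨G, hG0, hG⟩ := exists_oscB1_bound hcurv (hiter (K + 1) 1)
  -- The sum bounds each coefficient with `k ≤ K`, and the added `1` ensures `A ≤ A ^ k` for `k ≥
  -- 1`.
  set A : ℝ := 1 + ∑ k ∈ Finset.range (K + 1), (k.factorial : ℝ) * B k with hA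
  have hsum : ∀ k ∈ Finset.range (K + 1), 0 ≤ (k.factorial : ℝ) * B k := fun k _ =>
    mul_nonneg (Nat.cast_nonneg _) (hB0 k)
  have hA1 : 1 ≤ A := le_add_of_nonneg_right (Finset.sum_nonneg hsum)
  refine ⟨A, ∑ k ∈ Finset.range (K + 1), B k * F k + G, fun i => ⟨fun k hk => ?_,
    fun lam hlam => ?_⟩⟩
  · rw [Finset.mem_Icc] at hk
    have h1 : ‖expansionCoef (clamp (dB 2 (φ i))) (f i) k‖ ≤ (k.factorial : ℝ) * B k := by
      rw [expansionCoef, norm_mul, norm_mul, norm_pow, Complex.norm_I, one_pow, mul_one,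
        Complex.norm_natCast]
      exact mul_le_mul_of_nonneg_left (hB k i) (Nat.cast_nonneg _)
    have h3 := Finset.single_le_sum hsum (Finset.mem_range.2 (by omega : k < K + 1))
    calc _ ≤ (k.factorial : ℝ) * B k := h1
      _ ≤ A := by rw [hA]; linarith
      _ ≤ A ^ k := le_self_pow₀ hA1 (by omega)
  · set u := clamp (dB 2 (φ i)) with hudef
    have hflat : ∀ c : ℝ, |c| = 1 → FlatAt (f i) c := fun c hc => (hψ i).flatAt hc
    have hexp := oscB1_eq_sum hcurv hu hf i (hflat 1 (by simp)) (hflat (-1) (by simp)) hlam (K + 1)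
    rw [remainder_eq (hφ i) h2 (hψ i), hexp, sub_sub, ← mul_add, sum_expansionCoef u (f i) hlam K]
    set s := ∑ k ∈ Finset.range (K + 1),
      (Complex.I * (lam : ℂ)⁻¹) ^ k * leadCoef u ((reduce u)^[k] (f i)) with hs
    set R := oscB1 u lam ((reduce u)^[K + 1] (f i)) with hR
    have e : s * fresnel lam + (Complex.I * (lam : ℂ)⁻¹) ^ (K + 1) * R - prefactor lam * s =
        s * (fresnel lam - prefactor lam) + (Complex.I * (lam : ℂ)⁻¹) ^ (K + 1) * R := by ring
    rw [e, add_mul]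
    refine (norm_add_le _ _).trans (add_le_add ?_ ?_)
    · rw [hs, Finset.sum_mul, Finset.sum_mul]
      refine (norm_sum_le _ _).trans (Finset.sum_le_sum fun k hk => ?_)
      have hk' : k ≤ K := Nat.lt_succ_iff.1 (Finset.mem_range.1 hk)
      rw [norm_mul, norm_mul, norm_I_mul_inv_pow hlam]
      have hl : lam ^ (-(K : ℝ) - 3 / 2) = lam ^ (-(k : ℝ)) * lam ^ (-((K : ℝ) + 3 / 2 - k)) := by
        rw [← Real.rpow_add hlam]
        ring_nf
      rw [hl]
      calc _ ≤ lam ^ (-(k : ℝ)) * B k * (F k * lam ^ (-((K : ℝ) + 3 / 2 - k))) := by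
            refine mul_le_mul (mul_le_mul_of_nonneg_left (hB k i) (by positivity))
              (hF k hk' lam hlam) (norm_nonneg _) (mul_nonneg (by positivity) (hB0 k))
        _ = _ := by ring
    · have hl : lam ^ (-(K : ℝ) - 3 / 2) = lam ^ (-((K + 1 : ℕ) : ℝ)) * lam ^ (-(1 / 2) : ℝ) := by
        rw [← Real.rpow_add hlam]
        push_cast
        ring_nf
      rw [norm_mul, norm_I_mul_inv_pow hlam, hl]
      calc _ ≤ lam ^ (-((K + 1 : ℕ) : ℝ)) * (G * lam ^ (-(1 / 2) : ℝ)) :=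
            mul_le_mul_of_nonneg_left (hG i lam hlam) (by positivity)
        _ = _ := by ring

/-- The bounds in (3) are assumed in the open interval only; continuity of the one-sided derivatives
extends them to the endpoints. -/
lemma norm_le_on_B1_of_Ioo {E : Type*} [NormedAddCommGroup E] {g : ℝ → E}
    (hg : ContinuousOn g B1) {C : ℝ} (h : ∀ x, |x| < 1 → ‖g x‖ ≤ C) : ∀ x ∈ B1, ‖g x‖ ≤ C := by
  have hcl : closure (Ioo (-1 : ℝ) 1) = B1 := closure_Ioo (by norm_num)
  intro x hx
  rw [← hcl] at hx hg
  exact le_on_closure (fun y hy => h y (abs_lt.2 hy)) hg.norm continuousOn_const hx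

/-- The full stationary phase expansion with constants depending only on bounds for the
derivatives. -/
theorem exists_expansion (M : ℕ → ℝ) : ∃ A D : ℕ → ℝ, ∀ (φ : ℝ → ℝ) (ψ : ℝ → ℂ),
    IsPhase ∞ φ → IsAmplitude ψ →
    (∀ k : ℕ, ∀ x : ℝ, |x| < 1 → ‖dB k ψ x‖ ≤ M k ∧ |dB k φ x| ≤ M k) →
    ∃ a : ℕ → ℂ, ∀ K : ℕ, (∀ k ∈ Finset.Icc 1 K, ‖a k‖ ≤ A K ^ k) ∧
      ∀ lam : ℝ, 0 < lam → ‖remainder φ ψ lam - prefactor lam *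
        ∑ k ∈ Finset.Icc 1 K, a k * ((lam ^ (-(k : ℝ)) : ℝ) : ℂ) / (k.factorial : ℂ)‖ ≤
          D K * lam ^ (-(K : ℝ) - 3 / 2) := by
  let ι := {q : (ℝ → ℝ) × (ℝ → ℂ) // IsPhase ∞ q.1 ∧ IsAmplitude q.2 ∧
    ∀ k : ℕ, ∀ x : ℝ, |x| < 1 → ‖dB k q.2 x‖ ≤ M k ∧ |dB k q.1 x| ≤ M k}
  have hφ : ∀ (i : ι) (n : ℕ), ContDiffOn ℝ n i.1.1 B1 := fun i n =>
    i.2.1.contDiffOn.of_le (by exact_mod_cast le_top)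
  have hu : ∀ n, UniformCk n fun i : ι => clamp (dB 2 i.1.1) := fun n =>
    uniformCk_curvature (fun i => hφ i (n + 2)) fun k _ => ⟨M (k + 2), fun i =>
      norm_le_on_B1_of_Ioo (continuousOn_dB (hφ i (k + 2)) le_rfl) fun x hx => (i.2.2.2 _ x hx).2⟩
  have hf : ∀ n, UniformCk n fun i : ι => i.1.2 := fun n =>
    UniformCk.of_contDiffOn (fun i => i.2.2.1.contDiffOn n) fun k _ => ⟨M k, fun i =>
      norm_le_on_B1_of_Ioo (continuousOn_dB (i.2.2.1.contDiffOn k) le_rfl)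
        fun x hx => (i.2.2.2 k x hx).1⟩
  -- The constants are chosen for each `K` separately, while `expansionCoef` involves neither `K`
  -- nor `λ`.
  choose A D h using exists_expansion_bound (fun i : ι => i.2.1) (fun i => i.2.2.1) hu hf
  exact ⟨A, D, fun φ ψ h1 h2 h3 => ⟨expansionCoef (clamp (dB 2 φ)) ψ, fun K =>
    h K ⟨(φ, ψ), h1, h2, h3⟩⟩⟩

end Expansion

end StationaryPhase

end

theorem theorem1 :
    -- (1) for every finite exponent, with a constant depending on the exponent only
    (∀ p : ℝ, 1 ≤ p → ∃ C : ℝ, ∀ (φ : ℝ → ℝ) (ψ : ℝ → ℂ) (lam : ℝ),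
      StationaryPhase.IsPhase 3 φ → StationaryPhase.IsAmplitude ψ → 0 < lam →
      ‖StationaryPhase.remainder φ ψ lam‖ ≤ C * lam ^ (-1 + 1 / (2 * p)) *
        (StationaryPhase.lpNormB1 (ENNReal.ofReal p) (StationaryPhase.dB 3 φ) *
            StationaryPhase.lpNormB1 ⊤ ψ +
          StationaryPhase.lpNormB1 ⊤ (StationaryPhase.dB 1 ψ))) ∧
    -- (2) with a universal nondecreasing function of the two norms
    (∃ C : ℝ → ℝ → ℝ, (∀ a a' b b' : ℝ, a ≤ a' → b ≤ b' → C a b ≤ C a' b') ∧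
      ∀ (φ : ℝ → ℝ) (ψ : ℝ → ℂ) (lam : ℝ),
      StationaryPhase.IsPhase 4 φ → StationaryPhase.IsAmplitude ψ → 0 < lam →
      ‖StationaryPhase.remainder φ ψ lam‖ ≤ lam ^ (-(3 / 2) : ℝ) *
        C (StationaryPhase.SRange 2 4 φ) (StationaryPhase.SRange 0 2 ψ)) ∧
    -- (3) the full expansion, with constants depending only on the bounds `M` and on `K`,
    -- and coefficients depending only on the phase and the amplitude
    (∀ M : ℕ → ℝ, ∃ A D : ℕ → ℝ, ∀ (φ : ℝ → ℝ) (ψ : ℝ → ℂ),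
      StationaryPhase.IsPhase ∞ φ → StationaryPhase.IsAmplitude ψ →
      (∀ k : ℕ, ∀ x : ℝ, |x| < 1 →
        ‖StationaryPhase.dB k ψ x‖ ≤ M k ∧ |StationaryPhase.dB k φ x| ≤ M k) →
      ∃ a : ℕ → ℂ, ∀ K : ℕ,
        (∀ k ∈ Finset.Icc 1 K, ‖a k‖ ≤ A K ^ k) ∧
        ∀ lam : ℝ, 0 < lam →
          ‖StationaryPhase.remainder φ ψ lam - StationaryPhase.prefactor lam *
              ∑ k ∈ Finset.Icc 1 K, a k * ((lam ^ (-(k : ℝ)) : ℝ) : ℂ) / (k.factorial : ℂ)‖ ≤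
            D K * lam ^ (-(K : ℝ) - 3 / 2)) :=
  ⟨fun _ hp => StationaryPhase.exists_remainder_le_lpNorm hp,
    StationaryPhase.exists_remainder_le_SRange, StationaryPhase.exists_expansion⟩
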